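/- Let $q$ be a power of a prime, let $n\ge 1$, and let $U_n={\rm U}(n,\mathbb F_{q^2})$ be the group of invertible $n\times n$ matrices $g=(g_{ij})$ over $\mathbb F_{q^2}$ whose inverse is the transpose of $(g_{ij}^q)$. Let $x\in U_n$ be real, that is, conjugate in $U_n$ to $x^{-1}$. The elementary divisors of $x$ are the powers $d_1,\dots,d_r$ (with positive exponents) of monic irreducible polynomials over $\mathbb F_{q^2}$, listed with multiplicity, such that the $\mathbb F_{q^2}[t]$-module $\mathbb F_{q^2}^n$, on which $t$ acts as $x$, is isomorphic to $\bigoplus_i \mathbb F_{q^2}[t]/(d_i)$. Then $x$ is strongly real in $U_n$, that is, there is an involution $s\in U_n$ (an element of order $2$) with $sxs^{-1}=x^{-1}$, in either of the following cases: (a) $q$ is odd and, for every integer $m\ge 1$, each of $(t-1)^{2m}$ and $(t+1)^{2m}$ occurs with even (possibly zero) multiplicity among the elementary divisors of $x$; (b) $q$ is even, $n$ is even and, for every integer $m\ge 0$, $(t+1)^{2m+1}$ occurs with even (possibly zero) multiplicity among the elementary divisors of $x$. -/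

import Mathlib

open Polynomial

/-- An element of a group is real if it is conjugate to its inverse. -/
def IsRealElement {G : Type*} [Group G] (x : G) : Prop :=
  IsConj x x⁻¹

/-- An element of a group is strongly real if some involution (element of order exactly `2`)
conjugates it to its inverse. -/
def IsStronglyRealElement {G : Type*} [Group G] (x : G) : Prop :=
  ∃ s : G, orderOf s = 2 ∧ s * x * s⁻¹ = x⁻¹

/-- The finite unitary group `U(n, F_{q²})`, where `q = p ^ f` and `K` is a field with `q²`
elements: the invertible `n × n` matrices `g = (g_{ij})` over `K` whose inverse is the transpose
of `(g_{ij} ^ q)`. (`iterateFrobenius K p f` is the ring homomorphism `a ↦ a ^ (p ^ f)`.) -/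
def finiteUnitaryGroup (n p f : ℕ) (K : Type*) [Field K] [ExpChar K p] :
    Subgroup (GL (Fin n) K) where
  carrier := {g | (g : Matrix (Fin n) (Fin n) K) *
    ((g : Matrix (Fin n) (Fin n) K).map (iterateFrobenius K p f)).transpose = 1}
  one_mem' := by simp
  mul_mem' := by
    intro a b ha hb
    simp only [Set.mem_ofPred_eq, Units.val_mul, Matrix.map_mul, Matrix.transpose_mul] at *
    rw [Matrix.mul_assoc, ← Matrix.mul_assoc (b : Matrix (Fin n) (Fin n) K), hb,
      Matrix.one_mul, ha]
  inv_mem' := by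
    intro a ha
    simp only [Set.mem_ofPred_eq] at *
    have h1 : (a : Matrix (Fin n) (Fin n) K) * (↑a⁻¹ : Matrix (Fin n) (Fin n) K) = 1 := by
      rw [← Units.val_mul, mul_inv_cancel, Units.val_one]
    have h2 : (↑a⁻¹ : Matrix (Fin n) (Fin n) K) =
        ((a : Matrix (Fin n) (Fin n) K).map (iterateFrobenius K p f)).transpose := by
      calc (↑a⁻¹ : Matrix (Fin n) (Fin n) K)
          = (↑a⁻¹ : Matrix (Fin n) (Fin n) K) * ((a : Matrix (Fin n) (Fin n) K) *
            ((a : Matrix (Fin n) (Fin n) K).map (iterateFrobenius K p f)).transpose) := by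
              rw [ha, Matrix.mul_one]
        _ = _ := by rw [← Matrix.mul_assoc, ← Units.val_mul, inv_mul_cancel, Units.val_one,
              Matrix.one_mul]
    conv_lhs => arg 1; rw [h2]
    rw [← Matrix.transpose_mul, ← Matrix.map_mul, mul_eq_one_comm.mp h1,
      Matrix.map_one _ (map_zero _) (map_one _), Matrix.transpose_one]

/-- The finite family `d` is the family of elementary divisors, listed with multiplicity, of the
square matrix `A` over the field `K`: every `d i` is a positive power of a monic irreducible
polynomial, and the `K[t]`-module `Kⁿ`, on which `t` acts as `A`, is isomorphic to the direct
sum of the cyclic modules `K[t] / (d i)`. -/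
def IsElementaryDivisors {n r : ℕ} {K : Type*} [Field K] (A : Matrix (Fin n) (Fin n) K)
    (d : Fin r → K[X]) : Prop :=
  (∀ i, ∃ (P : K[X]) (k : ℕ), P.Monic ∧ Irreducible P ∧ 0 < k ∧ d i = P ^ k) ∧
    Nonempty (Module.AEval' (Matrix.toLin' A) ≃ₗ[K[X]]
      ((i : Fin r) → K[X] ⧸ Ideal.span {d i}))

/-- The multiplicity with which `g` occurs in the finite family `d`. -/
noncomputable def familyMultiplicity {r : ℕ} {α : Type*} (d : Fin r → α) (g : α) : ℕ :=
  Nat.card {i : Fin r // d i = g}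

/-! Write `A` for the matrix of `x` and `A*` for its conjugate transpose. It suffices to find some
nondegenerate Hermitian form `H` on the `K[X]`-module of `A` for which `A` is unitary, together with
an `H`-unitary `s` with `s² = 1` that inverts `A`. Indeed `A*HA = H` and `AA* = 1` force `A` to
commute with `H`. Over a field of `q²` elements `H = b*b` with `b` a polynomial in `H`
(`Matrix.exists_aeval_mul_eq`), so `b` commutes with `A` and carries `H` to the standard form. Then
`b s b⁻¹` is unitary, squares to `1` and inverts `A` (`Matrix.exists_unitary_involution`). No
classification of unitary conjugacy classes is needed.

The form is built from the module alone. Since `A` is similar to `A⁻¹ = A*`, multiplicities of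
elementary divisors are unchanged when `P` is replaced by its monic reciprocal or by `P^σ`. So the
module splits into pieces `K[X]/(F)`, with `F` a product of `k`-th powers over an orbit of these two
operations, and some pairs of equal summands.

On `K[X]/(F)`, with `d = deg F`, constant term `ε` and `t` the class of `X`, let `s` be the linear
and `st` the `σ`-semilinear automorphism inverting `t`, and `l` the coefficient of `t^(d-1)`. The
form `l(w · st(v) · u)` works as soon as `w` is a unit with `st w = s w` and `w = -ε s(w) t^(d-2)`.
Explicit Laurent binomials or monomials in `t` solve this, except for powers of `X ∓ 1` with even
exponent in odd characteristic or odd exponent in characteristic 2. By hypothesis those occur evenly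
often, and two equal copies carry a hyperbolic form.

The resulting `s` may be `1`. Then `x² = 1`, and an involution commuting with `x` is exhibited
directly; `n` even is needed for `x = 1` when `q` is even. -/

/-! ### Norm equations in commutative rings with involution -/

/-- A self-adjoint unipotent element of a commutative ring with involution is a norm, provided
that some element has trace `1`. -/
theorem exists_mul_map_eq_one_add {B : Type*} [CommRing B] (st : B →+* B) {l : B}
    (hl : l + st l = 1) (hll : st (st l) = l) (j : ℕ) (M : B) (hM : st M = M)
    (hnil : M ^ 2 ^ j = 0) : ∃ b, b * st b = 1 + M := by
  induction j generalizing M with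
  | zero => exact ⟨1, by simp_all⟩
  | succ j ih =>
    have hu : ∀ a : B, IsUnit (1 + a * M) := fun a => by
      refine IsNilpotent.isUnit_one_add ⟨2 ^ (j + 1), ?_⟩
      rw [mul_pow, hnil, mul_zero]
    obtain ⟨u, hu1⟩ := (hu l).exists_right_inv
    -- `M'` solves `(1 + lM)(1 + l̄M)(1 + M') = 1 + M`, where `l + l̄ = 1`. It is a multiple of
    -- `M²`, so its nilpotency exponent is half as large.
    obtain ⟨M', hM'⟩ : ∃ M', M' = -(l * st l) * (u * st u) * M ^ 2 := ⟨_, rfl⟩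
    have hstu : st (st u) = u := by
      have h2 := congrArg (fun z => st (st z)) hu1
      simp only [map_mul, map_add, map_one, hM, hll] at h2
      exact (hu l).mul_left_cancel (h2.trans hu1.symm)
    obtain ⟨b, hb⟩ := ih M' (by rw [hM']; simp only [map_mul, map_neg, map_pow, hM, hll, hstu]; ring)
      (by
        have : M' ^ 2 ^ j = (-(l * st l) * (u * st u)) ^ 2 ^ j * M ^ 2 ^ (j + 1) := by
          rw [hM', mul_pow, ← pow_mul, pow_succ' 2 j]
        rw [this, hnil, mul_zero])
    refine ⟨(1 + l * M) * b, ?_⟩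
    have h3 : st ((1 + l * M) * u) = 1 := by rw [hu1, map_one]
    simp only [map_mul, map_add, map_one, hM] at h3 ⊢
    have h4 : (1 + l * M) * b * ((1 + st l * M) * st b) =
        (1 + l * M) * (1 + st l * M) * (b * st b) := by ring
    rw [h4, hb, hM']
    linear_combination (-(l * st l) * M ^ 2 * ((1 + st l * M) * st u)) * hu1
      - (l * st l) * M ^ 2 * h3 + M * hl

/-- In a commutative algebra with a semilinear involution, a self-adjoint element `c` with
`c ^ 2 ^ i` a fixed scalar on the idempotent `e` is a norm on `e`. -/
theorem exists_mul_map_eq_of_pow_eq_algebraMap {K B : Type*} [Field K] [CommRing B] [Algebra K B]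
    (σ : K →+* K) (st : B →+* B) (hst : ∀ a, st (algebraMap K B a) = algebraMap K B (σ a))
    (hnorm : ∀ z, σ z = z → ∃ a, a * σ a = z) (h2 : (2 : K) ≠ 0)
    (hsq : ∀ z, σ z = z → ∃ y, y ^ 2 = z) (c : B) (hc : st c = c) (i : ℕ) (z : K) (hz : σ z = z)
    (hz0 : z ≠ 0) (e : B) (he : e * e = e) (hes : st e = e)
    (hi : e * c ^ 2 ^ i = e * algebraMap K B z) :
    ∃ b, e * b = b ∧ b * st b = e * c := by
  induction i generalizing z e with
  | zero =>
    obtain ⟨a, ha⟩ := hnorm z hz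
    refine ⟨e * algebraMap K B a, by rw [← mul_assoc, he], ?_⟩
    rw [pow_zero, pow_one] at hi
    rw [hi, ← ha, map_mul, map_mul, hst, hes]
    linear_combination (algebraMap K B a * algebraMap K B (σ a)) * he
  | succ i ih =>
    obtain ⟨y, hy⟩ := hsq z hz
    have hy0 : y ≠ 0 := by rintro rfl; simp at hy; exact hz0 hy.symm
    obtain ⟨k, hk⟩ : ∃ k : B, k = algebraMap K B (2⁻¹) := ⟨_, rfl⟩
    have hk2 : 2 * k = 1 := by
      rw [hk, ← map_ofNat (algebraMap K B) 2, ← map_mul, mul_inv_cancel₀ h2, map_one]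
    have hkst : st k = k := by rw [hk, hst, map_inv₀, map_ofNat]
    obtain ⟨w, hw⟩ : ∃ w : B, w = algebraMap K B y⁻¹ * c ^ 2 ^ i := ⟨_, rfl⟩
    have hyw : algebraMap K B y * w = c ^ 2 ^ i := by
      rw [hw, ← mul_assoc, ← map_mul, mul_inv_cancel₀ hy0, map_one, one_mul]
    have hw2 : e * w ^ 2 = e := by
      have h1 : algebraMap K B z⁻¹ * (e * c ^ 2 ^ (i + 1)) = e := by
        rw [hi, mul_left_comm, ← map_mul, inv_mul_cancel₀ hz0, map_one, mul_one]
      rw [hw, mul_pow, ← pow_mul, ← pow_succ, ← map_pow, inv_pow, hy]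
      linear_combination h1
    have hσy : σ y = y ∨ σ y = -y := by
      apply sq_eq_sq_iff_eq_or_eq_neg.mp
      rw [← map_pow, hy, hz]
    rcases hσy with hσ | hσ
    -- Here `w² = 1` on `e`, so `e(1 ± w)/2` are orthogonal self-adjoint idempotents on which `c ^ 2
    -- ^ i` is the fixed scalar `±y`. The norm equation is solved on each and the solutions are
    -- added.
    · have hwst : st w = w := by rw [hw, map_mul, hst, map_inv₀, hσ, map_pow, hc]
      obtain ⟨b, hb1, hb2⟩ := ih y hσ hy0 (e * (k * (1 + w)))
        (by linear_combination (k * k * (1 + w) ^ 2) * he + k * k * hw2 + e * k * (1 + w) * hk2)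
        (by simp only [map_mul, map_add, map_one, hes, hkst, hwst])
        (by rw [← hyw]; linear_combination k * algebraMap K B y * hw2)
      obtain ⟨b', hb1', hb2'⟩ := ih (-y) (by rw [map_neg, hσ]) (neg_ne_zero.mpr hy0)
        (e * (k * (1 - w)))
        (by linear_combination (k * k * (1 - w) ^ 2) * he + k * k * hw2 + e * k * (1 - w) * hk2)
        (by simp only [map_mul, map_sub, map_one, hes, hkst, hwst])
        (by rw [← hyw, map_neg]; linear_combination -k * algebraMap K B y * hw2)
      have hz1 : e * (k * (1 + w)) * (e * (k * (1 - w))) = 0 := by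
        linear_combination (k * k * (1 - w ^ 2)) * he - k * k * hw2
      have hs1 : st b = e * (k * (1 + w)) * st b := by
        conv_lhs => rw [← hb1]
        simp only [map_mul, map_add, map_one, hes, hkst, hwst]
      have hs2 : st b' = e * (k * (1 - w)) * st b' := by
        conv_lhs => rw [← hb1']
        simp only [map_mul, map_sub, map_one, hes, hkst, hwst]
      have c1 : b * st b' = 0 := by
        rw [← hb1, hs2]; linear_combination b * st b' * hz1
      have c2 : b' * st b = 0 := by
        rw [← hb1', hs1]; linear_combination b' * st b * hz1
      refine ⟨b + b', ?_, ?_⟩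
      · rw [mul_add]
        congr 1
        · rw [← hb1]; linear_combination (k * (1 + w) * b) * he
        · rw [← hb1']; linear_combination (k * (1 - w) * b') * he
      · rw [map_add]
        linear_combination hb2 + hb2' + c1 + c2 + e * c * hk2
    -- Now the involution swaps the idempotents `f = (1 + w)/2` and `f' = (1 - w)/2`, so `fc + f'`
    -- has norm `fc + f'c = c` on `e`; no induction is needed.
    · have hwst : st w = -w := by
        rw [hw, map_mul, hst, map_inv₀, hσ, map_pow, hc, ← neg_inv, map_neg, neg_mul]
      refine ⟨e * (k * (1 + w) * c + k * (1 - w)), by rw [← mul_assoc, he], ?_⟩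
      simp only [map_mul, map_add, map_sub, map_one, hes, hkst, hwst, hc]
      have h4 : e * (k * k * 4) = e := by linear_combination (e * (2 * k + 1)) * hk2
      linear_combination
        ((k * (1 + w) * c + k * (1 - w)) * (k * (1 - w) * c + k * (1 + w))) * he
        + (c * h4) + k * k * (2 * c - c ^ 2 - 1) * hw2

/-- Self-adjoint squares are norms, so only the 2-part of the order of `c` matters. An element of
2-power order is unipotent in characteristic 2 and is handled by splitting idempotents otherwise. -/
theorem exists_mul_map_eq_of_pow_eq_one {K B : Type*} [Field K] [CommRing B] [Algebra K B]
    (σ : K →+* K) (hσ : ∀ a, σ (σ a) = a)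
    (st : B →+* B) (hst : ∀ a, st (algebraMap K B a) = algebraMap K B (σ a))
    (hnorm : ∀ z, σ z = z → ∃ a, a * σ a = z) (htr : ∃ l, l + σ l = 1)
    (hsq : (2 : K) ≠ 0 → ∀ z, σ z = z → ∃ y, y ^ 2 = z) (c : B) (hc : st c = c)
    (N : ℕ) (hN : N ≠ 0) (hcN : c ^ N = 1) : ∃ b, b * st b = c := by
  obtain ⟨j, m, hm, rfl⟩ := Nat.exists_eq_two_pow_mul_odd hN
  have hw : (c ^ m) ^ 2 ^ j = 1 := by rw [← pow_mul, mul_comm, hcN]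
  have hws : st (c ^ m) = c ^ m := by rw [map_pow, hc]
  obtain ⟨b, hb⟩ : ∃ b, b * st b = c ^ m := by
    by_cases h2 : (2 : K) = 0
    · obtain ⟨l, hl⟩ := htr
      have h2B : (2 : B) = 0 := by rw [← map_ofNat (algebraMap K B) 2, h2, map_zero]
      have hnil : (c ^ m - 1) ^ 2 ^ j = 0 := by
        rcases subsingleton_or_nontrivial B with h | h
        · exact Subsingleton.elim _ _
        · have : CharP B 2 := CharTwo.of_one_ne_zero_of_two_eq_zero one_ne_zero h2B
          rw [sub_pow_char_pow, hw, one_pow, sub_self]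
      obtain ⟨b, hb⟩ := exists_mul_map_eq_one_add st (l := algebraMap K B l)
        (by rw [hst, ← map_add, hl, map_one]) (by rw [hst, hst, hσ]) j (c ^ m - 1)
        (by rw [map_sub, hws, map_one]) hnil
      exact ⟨b, by rw [hb]; ring⟩
    · obtain ⟨b, -, hb⟩ := exists_mul_map_eq_of_pow_eq_algebraMap σ st hst hnorm h2 (hsq h2) (c ^ m)
        hws j 1 (map_one σ) one_ne_zero 1 (one_mul 1) (map_one st) (by rw [hw, map_one])
      exact ⟨b, by rw [hb, one_mul]⟩
  obtain ⟨l, rfl⟩ := hm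
  obtain ⟨u, hu⟩ := (IsUnit.of_pow_eq_one hcN hN).exists_right_inv
  have hus : st u = u := by
    have h1 := congrArg st hu
    rw [map_mul, hc, map_one] at h1
    exact (IsUnit.of_pow_eq_one hcN hN).mul_left_cancel (h1.trans hu.symm)
  -- Here `m = 2l + 1` and `u = c⁻¹` is self-adjoint, so the norm is `c ^ (2l + 1) · u ^ (2l) = c`.
  refine ⟨b * u ^ l, ?_⟩
  have h5 : (c * u) ^ (2 * l) = 1 := by rw [hu, one_pow]
  rw [map_mul, map_pow, hus]
  calc b * u ^ l * (st b * u ^ l) = b * st b * u ^ (2 * l) := by ring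
    _ = c * (c * u) ^ (2 * l) := by rw [hb]; ring
    _ = c := by rw [h5, mul_one]

/-! ### Norms, square roots and traces for the field with `q²` elements -/

section FiniteField

variable {K : Type*} [Field K] {q : ℕ}

theorem one_lt_of_natCard_eq_sq (hK : Nat.card K = q ^ 2) (hf : Finite K) : 1 < q := by
  have h1 : 1 < Nat.card K := Finite.one_lt_card
  rw [hK] at h1
  by_contra! h
  have : q ^ 2 ≤ 1 ^ 2 := Nat.pow_le_pow_left h 2
  omega

theorem pow_pow_eq_self_of_natCard_eq_sq (hK : Nat.card K = q ^ 2) (hf : Finite K) (a : K) :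
    (a ^ q) ^ q = a := by
  have := Fintype.ofFinite K
  rw [← pow_mul, ← sq, ← hK, Nat.card_eq_fintype_card, FiniteField.pow_card]

/-- The unit group is cyclic of order `(q + 1)(q - 1)`: a power `g ^ k` of a generator is fixed by
Frobenius only if `q + 1` divides `k`, and then it is the norm of a power of `g`. -/
theorem exists_mul_pow_eq_of_natCard_eq_sq (hK : Nat.card K = q ^ 2) (hf : Finite K) (z : K)
    (hz : z ^ q = z) : ∃ a, a * a ^ q = z := by
  have hq := one_lt_of_natCard_eq_sq hK hf
  by_cases hz0 : z = 0
  · exact ⟨0, by rw [hz0, zero_mul]⟩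
  obtain ⟨g, hg⟩ := IsCyclic.exists_generator (α := Kˣ)
  obtain ⟨u, rfl⟩ : ∃ u : Kˣ, (u : K) = z := ⟨Units.mk0 z hz0, rfl⟩
  obtain ⟨k, rfl⟩ : ∃ k : ℕ, g ^ k = u := by
    have := hg u
    rwa [← mem_powers_iff_mem_zpowers] at this
  have hord : orderOf g = (q + 1) * (q - 1) := by
    rw [orderOf_eq_card_of_forall_mem_zpowers hg, Nat.card_units, hK, ← Nat.sq_sub_sq, one_pow]
  have h1 : g ^ (k * (q - 1)) = 1 := by
    have h2 : (g ^ k) ^ q = g ^ k := Units.ext (by simpa using hz)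
    rw [pow_mul]
    have h3 : (g ^ k) ^ (q - 1) * g ^ k = 1 * g ^ k := by
      rw [← pow_succ, Nat.sub_add_cancel hq.le, h2, one_mul]
    exact mul_right_cancel h3
  have h4 : (q + 1) * (q - 1) ∣ k * (q - 1) := hord ▸ orderOf_dvd_of_pow_eq_one h1
  obtain ⟨j, rfl⟩ := Nat.dvd_of_mul_dvd_mul_right (by omega) h4
  refine ⟨(g : K) ^ j, ?_⟩
  push_cast
  rw [← pow_succ', ← pow_mul]
  ring

/-- A fixed element is a norm `a ^ (q + 1)`, and `q + 1` is even. -/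
theorem exists_sq_eq_of_natCard_eq_sq (hK : Nat.card K = q ^ 2) (hf : Finite K) (hq : Odd q)
    (z : K) (hz : z ^ q = z) : ∃ y, y ^ 2 = z := by
  obtain ⟨a, ha⟩ := exists_mul_pow_eq_of_natCard_eq_sq hK hf z hz
  obtain ⟨j, rfl⟩ := hq
  exact ⟨a ^ (j + 1), by rw [← ha]; ring⟩

/-- If the trace vanished identically, `X ^ q + X` would have `q²` roots. A nonzero trace is fixed
by `σ` and can be divided out. -/
theorem exists_add_map_eq_one {σ : K →+* K} (hσ : ∀ a, σ a = a ^ q) (hK : Nat.card K = q ^ 2)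
    (hf : Finite K) : ∃ l, l + σ l = 1 := by
  have hq := one_lt_of_natCard_eq_sq hK hf
  have hσσ : ∀ a, σ (σ a) = a := fun a => by
    rw [hσ, hσ, pow_pow_eq_self_of_natCard_eq_sq hK hf]
  obtain ⟨a, ha⟩ : ∃ a : K, a + σ a ≠ 0 := by
    by_contra! h
    have := Fintype.ofFinite K
    have hP : (X ^ q + X : K[X]).natDegree = q := by
      rw [natDegree_add_eq_left_of_natDegree_lt (by rw [natDegree_X_pow, natDegree_X]; exact hq),
        natDegree_X_pow]
    have hP0 : (X ^ q + X : K[X]) ≠ 0 := by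
      intro h0; rw [h0, natDegree_zero] at hP; omega
    have h1 := card_roots' (X ^ q + X : K[X])
    have h2 : (Finset.univ : Finset K).val ≤ (X ^ q + X : K[X]).roots := by
      refine Multiset.le_iff_subset (Finset.nodup _) |>.mpr fun a _ => ?_
      rw [mem_roots hP0, IsRoot, eval_add, eval_pow, eval_X, ← hσ, add_comm]
      exact h a
    have h3 := (Multiset.card_le_card h2).trans h1
    rw [hP, Finset.card_val, Finset.card_univ, ← Nat.card_eq_fintype_card, hK] at h3
    nlinarith
  refine ⟨a * (a + σ a)⁻¹, ?_⟩
  rw [map_mul, map_inv₀, map_add, hσσ, add_comm (σ a) a, ← add_mul, mul_inv_cancel₀ ha]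

end FiniteField

/-! ### Hermitian matrices of the form `b* b` -/

/-- The conjugate transpose of a matrix with respect to an endomorphism of the base field. -/
def Matrix.sesquiTranspose {K m n : Type*} [Field K] (σ : K →+* K) (A : Matrix m n K) :
    Matrix n m K :=
  (A.map σ).transpose

section SesquiTranspose

variable {K n : Type*} [Field K] (σ : K →+* K)

theorem Matrix.sesquiTranspose_one [DecidableEq n] :
    (1 : Matrix n n K).sesquiTranspose σ = 1 := by
  simp [Matrix.sesquiTranspose]

variable [Fintype n]

theorem Matrix.sesquiTranspose_mul (A B : Matrix n n K) :
    (A * B).sesquiTranspose σ = B.sesquiTranspose σ * A.sesquiTranspose σ := by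
  simp [Matrix.sesquiTranspose, Matrix.map_mul, Matrix.transpose_mul]

variable [DecidableEq n]

theorem Matrix.aeval_transpose' (A : Matrix n n K) (g : K[X]) :
    aeval A.transpose g = (aeval A g).transpose := by
  induction g using Polynomial.induction_on' with
  | add a b ha hb => rw [map_add, map_add, ha, hb, Matrix.transpose_add]
  | monomial k a =>
    rw [aeval_monomial, aeval_monomial, ← Algebra.smul_def, ← Algebra.smul_def,
      Matrix.transpose_smul, Matrix.transpose_pow]

theorem Matrix.aeval_map_map (A : Matrix n n K) (g : K[X]) :
    aeval (A.map σ) (g.map σ) = (aeval A g).map σ := by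
  change _ = σ.mapMatrix (aeval A g)
  induction g using Polynomial.induction_on' with
  | add a b ha hb => rw [Polynomial.map_add, map_add, map_add, map_add, ha, hb]
  | monomial k a =>
    rw [map_monomial, aeval_monomial, aeval_monomial, ← Algebra.smul_def, ← Algebra.smul_def]
    have : σ.mapMatrix (a • A ^ k) = σ a • σ.mapMatrix (A ^ k) := by
      ext i j; simp
    rw [this, map_pow]; rfl

theorem Matrix.sesquiTranspose_aeval (A : Matrix n n K) (g : K[X]) :
    (aeval A g).sesquiTranspose σ = aeval (A.sesquiTranspose σ) (g.map σ) := by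
  rw [Matrix.sesquiTranspose, Matrix.sesquiTranspose, Matrix.aeval_transpose',
    Matrix.aeval_map_map]

/-- An invertible Hermitian matrix over a finite field is of the form `b* b` with `b` a polynomial
in the matrix. -/
theorem Matrix.exists_aeval_mul_eq [Finite K] (hσ : ∀ a, σ (σ a) = a)
    (hnorm : ∀ z, σ z = z → ∃ a, a * σ a = z) (htr : ∃ l, l + σ l = 1)
    (hsq : (2 : K) ≠ 0 → ∀ z, σ z = z → ∃ y, y ^ 2 = z) (H : Matrix n n K) (hH : IsUnit H)
    (hs : H.sesquiTranspose σ = H) :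
    ∃ g : K[X], (aeval H g).sesquiTranspose σ * aeval H g = H := by
  -- `K[X]/I` is the algebra generated by `H`. As `H` is Hermitian, conjugate transposition acts on
  -- it as `σ` on coefficients, so the commutative norm result applies to the class of `X`, which
  -- has finite order.
  let I : Ideal K[X] := RingHom.ker (aeval (R := K) H)
  have hI : I ≤ I.comap (mapRingHom σ) := by
    intro g hg
    rw [Ideal.mem_comap, RingHom.mem_ker, coe_mapRingHom, ← hs, ← Matrix.sesquiTranspose_aeval,
      RingHom.mem_ker.mp hg]
    ext i j; simp [Matrix.sesquiTranspose]
  obtain ⟨u, rfl⟩ := hH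
  obtain ⟨N, hN, huN⟩ := isOfFinOrder_iff_pow_eq_one.mp (isOfFinOrder_of_finite u)
  obtain ⟨b, hb⟩ := exists_mul_map_eq_of_pow_eq_one (B := K[X] ⧸ I) σ hσ
    (Ideal.quotientMap I (mapRingHom σ) hI)
    (fun a => by
      change Ideal.quotientMap I (mapRingHom σ) hI (Ideal.Quotient.mk I (C a)) =
        Ideal.Quotient.mk I (C (σ a))
      rw [Ideal.quotientMap_mk, coe_mapRingHom, map_C])
    hnorm htr hsq (Ideal.Quotient.mk I X) (by rw [Ideal.quotientMap_mk, coe_mapRingHom, map_X])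
    N hN.ne' (by
      rw [← map_pow, ← map_one (Ideal.Quotient.mk I), Ideal.Quotient.eq, RingHom.mem_ker, map_sub,
        map_pow, aeval_X, map_one, ← Units.val_pow_eq_pow_val, huN, Units.val_one, sub_self])
  obtain ⟨g, rfl⟩ := Ideal.Quotient.mk_surjective b
  refine ⟨g, ?_⟩
  rw [Ideal.quotientMap_mk, ← map_mul, Ideal.Quotient.eq, RingHom.mem_ker, map_sub, aeval_X,
    coe_mapRingHom, map_mul, sub_eq_zero] at hb
  rw [Matrix.sesquiTranspose_aeval, hs, ← map_mul, mul_comm, map_mul, hb]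

end SesquiTranspose

/-! ### Modules with a Hermitian form and an isometric involution inverting `X` -/

/-- A nondegenerate Hermitian form on a `K[X]`-module for which `X` acts unitarily, together with
a unitary involution that conjugates the action of `X` to its inverse. -/
structure ReversibleHermitianStructure {K : Type*} [Field K] (σ : K →+* K) (M : Type*)
    [AddCommGroup M] [Module K[X] M] where
  form : M → M → K
  inv : M → M
  form_add : ∀ v w w', form v (w + w') = form v w + form v w'
  form_smul : ∀ v a w, form v ((C a : K[X]) • w) = a * form v w
  form_symm : ∀ v w, σ (form v w) = form w v
  nondeg : ∀ w, (∀ v, form v w = 0) → w = 0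
  form_X : ∀ v w, form ((X : K[X]) • v) ((X : K[X]) • w) = form v w
  inv_add : ∀ v w, inv (v + w) = inv v + inv w
  inv_smul : ∀ (a : K) v, inv ((C a : K[X]) • v) = (C a : K[X]) • inv v
  inv_inv : ∀ v, inv (inv v) = v
  X_smul_inv : ∀ v, (X : K[X]) • inv ((X : K[X]) • v) = inv v
  form_inv : ∀ v w, form (inv v) (inv w) = form v w

namespace ReversibleHermitianStructure

variable {K : Type*} [Field K] {σ : K →+* K}

/-- The orthogonal sum of two structures. -/
noncomputable def prod {M N : Type*} [AddCommGroup M] [Module K[X] M] [AddCommGroup N] [Module K[X] N]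
    (S : ReversibleHermitianStructure σ M) (T : ReversibleHermitianStructure σ N) :
    ReversibleHermitianStructure σ (M × N) where
  form v w := S.form v.1 w.1 + T.form v.2 w.2
  inv v := (S.inv v.1, T.inv v.2)
  form_add v w w' := by simp only [Prod.fst_add, Prod.snd_add, S.form_add, T.form_add]; ring
  form_smul v a w := by simp only [Prod.smul_fst, Prod.smul_snd, S.form_smul, T.form_smul]; ring
  form_symm v w := by rw [map_add, S.form_symm, T.form_symm]
  nondeg w hw := by
    have hS : ∀ v, S.form v 0 = 0 := fun v => by
      have := S.form_add v 0 0
      rwa [add_zero, left_eq_add] at this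
    have hT : ∀ v, T.form v 0 = 0 := fun v => by
      have := T.form_add v 0 0
      rwa [add_zero, left_eq_add] at this
    have hS' : ∀ v, S.form 0 v = 0 := fun v => by rw [← S.form_symm, hS, map_zero]
    have hT' : ∀ v, T.form 0 v = 0 := fun v => by rw [← T.form_symm, hT, map_zero]
    refine Prod.ext (S.nondeg _ fun v => ?_) (T.nondeg _ fun v => ?_)
    · simpa [hT'] using hw (v, 0)
    · simpa [hS'] using hw (0, v)
  form_X v w := by simp only [Prod.smul_fst, Prod.smul_snd, S.form_X, T.form_X]
  inv_add v w := by simp only [Prod.fst_add, Prod.snd_add, S.inv_add, T.inv_add, Prod.mk_add_mk]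
  inv_smul a v := by simp only [Prod.smul_fst, Prod.smul_snd, S.inv_smul, T.inv_smul, Prod.smul_mk]
  inv_inv v := by simp only [S.inv_inv, T.inv_inv]
  X_smul_inv v := by
    simp only [Prod.smul_fst, Prod.smul_snd, Prod.smul_mk, S.X_smul_inv, T.X_smul_inv]
  form_inv v w := by simp only [S.form_inv, T.form_inv]

/-- Transport of a structure along an isomorphism. -/
noncomputable def congr {M N : Type*} [AddCommGroup M] [Module K[X] M] [AddCommGroup N] [Module K[X] N]
    (e : N ≃ₗ[K[X]] M) (S : ReversibleHermitianStructure σ M) :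
    ReversibleHermitianStructure σ N where
  form v w := S.form (e v) (e w)
  inv v := e.symm (S.inv (e v))
  form_add v w w' := by rw [map_add, S.form_add]
  form_smul v a w := by rw [map_smul, S.form_smul]
  form_symm v w := S.form_symm _ _
  nondeg w hw := by
    rw [← e.map_eq_zero_iff]
    exact S.nondeg _ fun v => by simpa using hw (e.symm v)
  form_X v w := by rw [map_smul, map_smul, S.form_X]
  inv_add v w := by rw [map_add, S.inv_add, map_add]
  inv_smul a v := by rw [map_smul, S.inv_smul, map_smul]
  inv_inv v := by rw [e.apply_symm_apply, S.inv_inv, e.symm_apply_apply]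
  X_smul_inv v := by rw [← map_smul, map_smul e, S.X_smul_inv]
  form_inv v w := by rw [e.apply_symm_apply, e.apply_symm_apply, S.form_inv]

/-- A structure on `Kⁿ`, with `X` acting as the matrix `A`, in terms of matrices. -/
theorem exists_matrix {n : Type*} [Fintype n] [DecidableEq n] (A : Matrix n n K)
    (S : ReversibleHermitianStructure σ (Module.AEval' (Matrix.toLin' A))) :
    ∃ H s : Matrix n n K, IsUnit H ∧ H.sesquiTranspose σ = H ∧
      A.sesquiTranspose σ * H * A = H ∧ s.sesquiTranspose σ * H * s = H ∧ s * s = 1 ∧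
      A * s * A = s := by
  let o := Module.AEval'.of (Matrix.toLin' A)
  let h : (n → K) → (n → K) → K := fun v w => S.form (o v) (o w)
  let t : (n → K) → (n → K) := fun v => o.symm (S.inv (o v))
  have hC : ∀ (a : K) v, o (a • v) = (C a : K[X]) • o v := fun a v => by
    rw [map_smul, Module.AEval.C_smul]
  have hX : ∀ v, o (A.mulVec v) = (X : K[X]) • o v := fun v => by
    rw [Module.AEval'.X_smul_of, Matrix.toLin'_apply]
  have h_add : ∀ v w w', h v (w + w') = h v w + h v w' := fun v w w' => by
    simp only [h, map_add, S.form_add]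
  have h_smul : ∀ v a w, h v (a • w) = a * h v w := fun v a w => by
    simp only [h, hC, S.form_smul]
  have h_symm : ∀ v w, σ (h v w) = h w v := fun v w => S.form_symm _ _
  let hl : (n → K) → (n → K) →ₗ[K] K := fun v => ⟨⟨h v, h_add v⟩, h_smul v⟩
  let tl : (n → K) →ₗ[K] (n → K) :=
    ⟨⟨t, fun v w => by simp only [t, map_add, S.inv_add]⟩, fun a v => by
      simp only [t, hC, S.inv_smul, RingHom.id_apply]
      rw [o.symm_apply_eq, hC, o.apply_symm_apply]⟩
  let H : Matrix n n K := Matrix.of fun i j => h (Pi.single i 1) (Pi.single j 1)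
  have hexp : ∀ v w, h v w = ∑ j, h v (Pi.single j 1) * w j := fun v w => by
    have h1 : hl v w = ∑ j, w j • hl v (Pi.single j 1) := by
      conv_lhs => rw [← Finset.univ_sum_single w, map_sum]
      refine Finset.sum_congr rfl fun j _ => ?_
      rw [← map_smul, ← Pi.single_smul, smul_eq_mul, mul_one]
    refine h1.trans (Finset.sum_congr rfl fun j _ => mul_comm _ _)
  have hHv : ∀ v w, h v w = ∑ i, σ (v i) * (H.mulVec w) i := fun v w => by
    have h2 : ∀ j, h v (Pi.single j 1) = ∑ i, σ (v i) * H i j := fun j => by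
      rw [← h_symm, hexp, map_sum]
      refine Finset.sum_congr rfl fun i _ => ?_
      rw [map_mul, h_symm, mul_comm]; rfl
    rw [hexp]
    simp only [h2, Matrix.mulVec, dotProduct, Finset.mul_sum, Finset.sum_mul]
    rw [Finset.sum_comm]
    exact Finset.sum_congr rfl fun i _ => Finset.sum_congr rfl fun j _ => by ring
  have hinv : ∀ B : Matrix n n K, (∀ v w, h (B.mulVec v) (B.mulVec w) = h v w) →
      B.sesquiTranspose σ * H * B = H := by
    intro B hB
    ext i j
    have h3 := hB (Pi.single i 1) (Pi.single j 1)
    have h4 : H i j = h (Pi.single i 1) (Pi.single j 1) := rfl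
    rw [h4, ← h3, hHv, Matrix.mul_assoc, Matrix.mul_apply, Matrix.mulVec_single_one,
      Matrix.mulVec_single_one]
    rfl
  refine ⟨H, LinearMap.toMatrix' tl, ?_, ?_, ?_, ?_, ?_, ?_⟩
  · rw [← Matrix.mulVec_injective_iff_isUnit]
    intro v w hvw
    have h5 : o (v - w) = 0 := S.nondeg _ fun u => by
      have := hHv (o.symm u) (v - w)
      rw [Matrix.mulVec_sub, sub_eq_zero.mpr hvw] at this
      simpa [h] using this
    rwa [o.map_eq_zero_iff, sub_eq_zero] at h5
  · ext i j
    exact h_symm _ _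
  · exact hinv A fun v w => by simp only [h, hX, S.form_X]
  · refine hinv _ fun v w => ?_
    rw [LinearMap.toMatrix'_mulVec, LinearMap.toMatrix'_mulVec]
    simp only [h, tl, t, LinearMap.coe_mk, AddHom.coe_mk, o.apply_symm_apply, S.form_inv]
  · rw [← LinearMap.toMatrix'_comp, ← LinearMap.toMatrix'_id]
    congr 1
    ext1 v
    ext1
    simp [tl, t, S.inv_inv]
  · rw [← LinearMap.toMatrix'_toLin' A, ← LinearMap.toMatrix'_comp, ← LinearMap.toMatrix'_comp]
    congr 1
    apply LinearMap.ext
    intro v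
    simp only [LinearMap.comp_apply, Matrix.toLin'_apply, tl, t, LinearMap.coe_mk, AddHom.coe_mk]
    rw [hX, ← o.symm_apply_apply (A.mulVec _), hX, o.apply_symm_apply, S.X_smul_inv]

end ReversibleHermitianStructure

/-! ### Forms on cyclic modules with self-reciprocal annihilator -/

theorem Ideal.Quotient.smul_eq_mk_mul {R : Type*} [CommRing R] {I : Ideal R} (g : R)
    (v : R ⧸ I) : g • v = Ideal.Quotient.mk I g * v := by
  obtain ⟨a, rfl⟩ := Ideal.Quotient.mk_surjective v
  rfl

/-- The data on `K[X]/(F)` for `F` invariant under `σ` and self-reciprocal up to the constant `ε`: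
the automorphism `s` inverting `X`, the `σ`-semilinear automorphism `st` inverting `X`, and a
nondegenerate functional. -/
structure SelfReciprocalQuotient {K : Type*} [Field K] (σ : K →+* K) (F : K[X]) (ε : K) where
  s : K[X] ⧸ Ideal.span {F} →+* K[X] ⧸ Ideal.span {F}
  st : K[X] ⧸ Ideal.span {F} →+* K[X] ⧸ Ideal.span {F}
  ti : K[X] ⧸ Ideal.span {F}
  l : K[X] ⧸ Ideal.span {F} →+ K
  t_mul_ti : Ideal.Quotient.mk _ X * ti = 1
  s_t : s (Ideal.Quotient.mk _ X) = ti
  st_t : st (Ideal.Quotient.mk _ X) = ti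
  s_ti : s ti = Ideal.Quotient.mk _ X
  st_ti : st ti = Ideal.Quotient.mk _ X
  s_C : ∀ a, s (Ideal.Quotient.mk _ (C a)) = Ideal.Quotient.mk _ (C a)
  st_C : ∀ a, st (Ideal.Quotient.mk _ (C a)) = Ideal.Quotient.mk _ (C (σ a))
  s_s : ∀ a, s (s a) = a
  st_st : ∀ a, st (st a) = a
  s_st : ∀ a, s (st a) = st (s a)
  l_C_mul : ∀ a v, l (Ideal.Quotient.mk _ (C a) * v) = a * l v
  l_st_s : ∀ v, l (st (s v)) = σ (l v)
  l_nondeg : ∀ v, (∀ u, l (u * v) = 0) → v = 0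
  l_s : ∀ v, l (s v * Ideal.Quotient.mk _ X ^ F.natDegree * ti ^ 2) = -ε * l v

section

variable {K : Type*} [Field K] {F : K[X]} {ε : K}

theorem Polynomial.Monic.coeff_zero_eq_of_reverse_eq (hF : F.Monic) (hε : F.reverse = C ε * F) :
    F.coeff 0 = ε := by
  have h1 := congrArg (fun g => coeff g F.natDegree) hε
  simpa [coeff_reverse, revAt_le le_rfl, hF.coeff_natDegree] using h1

theorem Polynomial.Monic.mul_self_eq_one_of_reverse_eq (hF : F.Monic)
    (hε : F.reverse = C ε * F) : ε * ε = 1 := by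
  have h1 := congrArg (fun g => coeff g 0) hε
  simp only [coeff_zero_reverse, hF.leadingCoeff, coeff_C_mul,
    hF.coeff_zero_eq_of_reverse_eq hε] at h1
  exact h1.symm

theorem SelfReciprocalQuotient.nonempty (σ : K →+* K) (hσσ : ∀ a, σ (σ a) = a) (hF : F.Monic)
    (hd : 0 < F.natDegree) (hσ : F.map σ = F) (hε : F.reverse = C ε * F) :
    Nonempty (SelfReciprocalQuotient σ F ε) := by
  have hε0 := hF.coeff_zero_eq_of_reverse_eq hε
  have hε1 := hF.mul_self_eq_one_of_reverse_eq hε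
  let π := Ideal.Quotient.mk (Ideal.span {F})
  have hπF : π F = 0 := Ideal.Quotient.eq_zero_iff_mem.mpr (Ideal.mem_span_singleton_self F)
  -- From `F = X · F.divX + ε` and `ε² = 1`.
  let ti := π (-C ε * F.divX)
  have htti : π X * ti = 1 := by
    have h1 := congrArg π (divX_mul_X_add F)
    rw [hε0, map_add, map_mul, hπF] at h1
    have h2 : π (C ε) * π (C ε) = 1 := by rw [← map_mul, ← map_mul, hε1, map_one, map_one]
    simp only [ti, map_mul, map_neg]
    linear_combination h2 - π (C ε) * h1
  let : Invertible (π X) := invertibleOfRightInverse _ _ htti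
  have hinv : ⅟(π X) = ti := rfl
  have hev : ∀ g : K[X], g.eval₂ (π.comp C) (π X) = π g := fun g => by
    rw [← coe_eval₂RingHom]
    congr 1
    exact ringHom_ext (fun a => by simp) (by simp)
  -- `t^d F(t⁻¹)` is the reverse of `F` at `t`, hence `ε F(t) = 0`. So sending `X` to `t⁻¹` descends
  -- to the quotient, linearly and, since `F^σ = F`, semilinearly.
  have hti : F.eval₂ (π.comp C) ti = 0 := by
    have h1 := eval₂_reverse_mul_pow (π.comp C) (π X) F
    rw [hev, hπF, hinv, hε, eval₂_mul, eval₂_C] at h1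
    have h2 : (π.comp C) ε * (π.comp C) ε = 1 := by rw [← map_mul, hε1, map_one]
    have h3 : π X ^ F.natDegree * ti ^ F.natDegree = 1 := by rw [← mul_pow, htti, one_pow]
    linear_combination (π.comp C) ε * ti ^ F.natDegree * h1 - F.eval₂ (π.comp C) ti * h2
      - (π.comp C) ε * (π.comp C) ε * F.eval₂ (π.comp C) ti * h3
  have hti' : F.eval₂ ((π.comp C).comp σ) ti = 0 := by
    rw [← eval₂_map, hσ, hti]
  let s : K[X] ⧸ Ideal.span {F} →+* K[X] ⧸ Ideal.span {F} :=
    Ideal.Quotient.lift _ (eval₂RingHom (π.comp C) ti) fun g hg => by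
      obtain ⟨c, rfl⟩ := Ideal.mem_span_singleton.mp hg
      rw [map_mul, coe_eval₂RingHom, hti, zero_mul]
  let st : K[X] ⧸ Ideal.span {F} →+* K[X] ⧸ Ideal.span {F} :=
    Ideal.Quotient.lift _ (eval₂RingHom ((π.comp C).comp σ) ti) fun g hg => by
      obtain ⟨c, rfl⟩ := Ideal.mem_span_singleton.mp hg
      rw [map_mul, coe_eval₂RingHom, hti', zero_mul]
  have s_t : s (π X) = ti := by simp [s, π]
  have st_t : st (π X) = ti := by simp [st, π]
  have s_C : ∀ a, s (π (C a)) = π (C a) := fun a => by simp [s, π]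
  have st_C : ∀ a, st (π (C a)) = π (C (σ a)) := fun a => by simp [st, π]
  have hfix : ∀ f : K[X] ⧸ Ideal.span {F} →+* K[X] ⧸ Ideal.span {F}, f (π X) = ti →
      f ti = π X := fun f hf => by
    have h1 := congrArg f htti
    rw [map_mul, map_one, hf] at h1
    linear_combination -f ti * htti + π X * h1
  have s_ti := hfix s s_t
  have st_ti := hfix st st_t
  have hext : ∀ f g : K[X] ⧸ Ideal.span {F} →+* K[X] ⧸ Ideal.span {F}, f (π X) = g (π X) →
      (∀ a, f (π (C a)) = g (π (C a))) → ∀ v, f v = g v := fun f g h1 h2 v => by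
    have : f = g := Ideal.Quotient.ringHom_ext (ringHom_ext h2 h1)
    rw [this]
  let L : K[X] →ₗ[K] K := (lcoeff K (F.natDegree - 1)).comp (modByMonicHom F)
  have hL : ∀ g, L g = (g %ₘ F).coeff (F.natDegree - 1) := fun g => rfl
  let l : K[X] ⧸ Ideal.span {F} →+ K := QuotientAddGroup.lift _ L.toAddMonoidHom fun g hg => by
      obtain ⟨c, rfl⟩ := Ideal.mem_span_singleton.mp hg
      change L (F * c) = 0
      rw [hL, (modByMonic_eq_zero_iff_dvd hF).mpr (dvd_mul_right F c), coeff_zero]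
  have hl : ∀ g, l (π g) = (g %ₘ F).coeff (F.natDegree - 1) := fun g => rfl
  have hl' : ∀ g : K[X], g.natDegree < F.natDegree → l (π g) = g.coeff (F.natDegree - 1) :=
    fun g hg => by
      rw [hl, (modByMonic_eq_self_iff hF).mpr (degree_lt_degree hg)]
  have hrep : ∀ v, ∃ g : K[X], π g = v ∧ g.natDegree < F.natDegree := fun v => by
    obtain ⟨g, rfl⟩ := Ideal.Quotient.mk_surjective v
    refine ⟨g %ₘ F, ?_, natDegree_modByMonic_lt g hF ?_⟩
    · have h1 := congrArg π (modByMonic_add_div g F)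
      rw [map_add, map_mul, hπF, zero_mul, add_zero] at h1
      exact h1
    · rintro rfl; simp at hd
  have l_C : ∀ a v, l (π (C a) * v) = a * l v := fun a v => by
    obtain ⟨g, rfl⟩ := Ideal.Quotient.mk_surjective v
    change L (C a * g) = a * L g
    rw [← smul_eq_C_mul, map_smul, smul_eq_mul]
  have l_ti : l ti = -ε := by
    change l (π (-C ε * F.divX)) = -ε
    rw [hl', neg_mul, coeff_neg, coeff_C_mul, coeff_divX, Nat.sub_add_cancel hd,
      hF.coeff_natDegree, mul_one]
    rw [neg_mul, natDegree_neg]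
    refine (natDegree_C_mul_le _ _).trans_lt ?_
    rw [natDegree_divX_eq_natDegree_tsub_one]
    omega
  refine ⟨⟨s, st, ti, l, htti, s_t, st_t, s_ti, st_ti, s_C, st_C,
    hext (s.comp s) (RingHom.id _) (by simp [s_t, s_ti]) (by simp [s_C]),
    hext (st.comp st) (RingHom.id _) (by simp [st_t, st_ti]) (by simp [st_C, hσσ]),
    hext (s.comp st) (st.comp s) (by simp [s_t, s_ti, st_t, st_ti]) (by simp [s_C, st_C]),
    l_C, fun v => ?_, fun v hv => ?_, fun v => ?_⟩⟩
  · obtain ⟨g, rfl⟩ := Ideal.Quotient.mk_surjective v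
    have h1 : st (s (π g)) = π (g.map σ) :=
      congrArg (fun f => f g) (ringHom_ext (f := (st.comp s).comp π) (g := π.comp (mapRingHom σ))
        (fun a => by simp [s_C, st_C]) (by simp [s_t, st_ti]))
    have h2 := map_modByMonic (p := g) σ hF
    rw [hσ] at h2
    rw [h1, hl, hl, ← h2, coeff_map]
  · obtain ⟨g, rfl, hg⟩ := hrep v
    by_contra hne
    have hg0 : g ≠ 0 := by rintro rfl; exact hne (map_zero π)
    -- This multiplier moves the leading term of `g` to degree `d - 1`, where `l` reads it off.
    have h1 := hv (π (X ^ (F.natDegree - 1 - g.natDegree)))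
    rw [← map_mul, hl', coeff_X_pow_mul', if_pos (by omega)] at h1
    · rw [show F.natDegree - 1 - (F.natDegree - 1 - g.natDegree) = g.natDegree by omega,
        coeff_natDegree, leadingCoeff_eq_zero] at h1
      exact hg0 h1
    · rw [natDegree_X_pow_mul _ hg0]; omega
  · obtain ⟨g, rfl, hg⟩ := hrep v
    -- The operation sends `t^i` to `t^(d-2-i)`. For `i < d - 1` both sides vanish; for `i = d - 1`
    -- the result is `t⁻¹`, whose top coefficient is `-ε`.
    have hmon : ∀ i < F.natDegree, l (s (π (X ^ i)) * π X ^ F.natDegree * ti ^ 2) =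
        -ε * l (π (X ^ i)) := fun i hi => by
      have h3 : ti ^ i * π X ^ i = 1 := by rw [← mul_pow, mul_comm, htti, one_pow]
      rw [hl' _ (by rwa [natDegree_X_pow]), coeff_X_pow, map_pow, map_pow, s_t]
      rcases Nat.lt_or_ge (i + 1) F.natDegree with h | h
      · obtain ⟨j, hj⟩ : ∃ j, F.natDegree = i + (j + 2) := ⟨F.natDegree - i - 2, by omega⟩
        have h4 : ti ^ i * π X ^ F.natDegree * ti ^ 2 = π (X ^ j) := by
          rw [hj, map_pow]
          linear_combination π X ^ (j + 2) * ti ^ 2 * h3 + π X ^ j * (π X * ti + 1) * htti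
        rw [h4, hl' _ (by rw [natDegree_X_pow]; omega), coeff_X_pow, if_neg (by omega),
          if_neg (by omega), mul_zero]
      · have h4 : ti ^ i * π X ^ F.natDegree * ti ^ 2 = ti := by
          rw [show F.natDegree = i + 1 by omega]
          linear_combination π X * ti ^ 2 * h3 + ti * htti
        rw [h4, l_ti, if_pos (by omega), mul_one]
    conv_lhs => rw [g.as_sum_range_C_mul_X_pow' hg]
    conv_rhs => rw [g.as_sum_range_C_mul_X_pow' hg]
    simp only [map_sum, Finset.sum_mul, Finset.mul_sum]
    refine Finset.sum_congr rfl fun i hi => ?_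
    rw [map_mul π, map_mul s, s_C, mul_assoc, mul_assoc, l_C, l_C, ← mul_assoc (s _),
      hmon i (Finset.mem_range.mp hi)]
    ring

end

namespace SelfReciprocalQuotient

variable {K : Type*} [Field K] {σ : K →+* K} {F : K[X]} {ε : K}

/-- The rank one structure on `K[X]/(F)` attached to a unit `w`. -/
noncomputable def rankOne (Q : SelfReciprocalQuotient σ F ε) {w : K[X] ⧸ Ideal.span {F}}
    (hw : IsUnit w) (hst : Q.st w = Q.s w)
    (hws : w = -(Ideal.Quotient.mk _ (C ε) * Q.s w * Ideal.Quotient.mk _ X ^ F.natDegree *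
      Q.ti ^ 2)) :
    ReversibleHermitianStructure σ (K[X] ⧸ Ideal.span {F}) :=
  -- The equation for `w` compensates the twist in `l_s`, so `a ↦ l(wa)` is `s`-invariant. This
  -- makes `s` an isometry and, with `st w = s w`, the form Hermitian.
  have hs : ∀ a, Q.l (w * Q.s a) = Q.l (w * a) := fun a => by
    have h1 := Q.l_s (Q.s w * a * Ideal.Quotient.mk _ X ^ F.natDegree * Q.ti ^ 2)
    have h2 : (Ideal.Quotient.mk (Ideal.span {F}) X) ^ (F.natDegree + 2) *
        Q.ti ^ (F.natDegree + 2) = 1 := by rw [← mul_pow, Q.t_mul_ti, one_pow]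
    have h3 : Q.s (Q.s w * a * Ideal.Quotient.mk _ X ^ F.natDegree * Q.ti ^ 2) *
        Ideal.Quotient.mk _ X ^ F.natDegree * Q.ti ^ 2 = w * Q.s a := by
      simp only [map_mul, map_pow, Q.s_s, Q.s_t, Q.s_ti]
      linear_combination w * Q.s a * h2
    have h4 : w * a = -(Ideal.Quotient.mk _ (C ε) *
        (Q.s w * a * Ideal.Quotient.mk _ X ^ F.natDegree * Q.ti ^ 2)) := by
      linear_combination a * hws
    rw [h3] at h1
    rw [h1, h4, map_neg, Q.l_C_mul, neg_mul]
  have hσ : ∀ a, Q.l (w * Q.st a) = σ (Q.l (w * a)) := fun a => by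
    rw [← hs a, ← Q.l_st_s, map_mul Q.s, map_mul Q.st, Q.s_s, ← Q.s_st, hst, Q.s_s]
  { form v u := Q.l (w * (Q.st v * u))
    inv v := Q.s v
    form_add v u u' := by rw [← map_add]; congr 1; ring
    form_smul v a u := by
      rw [← Q.l_C_mul, Ideal.Quotient.smul_eq_mk_mul]; congr 1; ring
    form_symm v u := by rw [← hσ, map_mul Q.st, Q.st_st, mul_comm v]
    nondeg u hu := Q.l_nondeg u fun v => by
      obtain ⟨w', hw'⟩ := hw.exists_right_inv
      have := hu (Q.st (w' * v))
      rw [Q.st_st] at this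
      rw [← this]; congr 1
      linear_combination -v * u * hw'
    form_X v u := by
      simp only [Ideal.Quotient.smul_eq_mk_mul]
      rw [map_mul Q.st, Q.st_t]; congr 1
      linear_combination w * Q.st v * u * Q.t_mul_ti
    inv_add v u := map_add _ _ _
    inv_smul a v := by
      simp only [Ideal.Quotient.smul_eq_mk_mul]
      rw [map_mul, Q.s_C]
    inv_inv v := Q.s_s v
    X_smul_inv v := by
      simp only [Ideal.Quotient.smul_eq_mk_mul]
      rw [map_mul, Q.s_t, ← mul_assoc, Q.t_mul_ti, one_mul]
    form_inv v u := by rw [← Q.s_st, ← map_mul Q.s, hs] }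

/-- The hyperbolic structure on the square of `K[X]/(F)`. -/
noncomputable def hyperbolic (Q : SelfReciprocalQuotient σ F ε) :
    ReversibleHermitianStructure σ ((K[X] ⧸ Ideal.span {F}) × (K[X] ⧸ Ideal.span {F})) where
  -- The `s` in the second summand makes the twisted swap exchange the two summands; thus no parity
  -- condition on `F` arises.
  form v u := Q.l (Q.st v.1 * u.2) + Q.l (Q.s (Q.st v.2 * u.1))
  inv v := (Q.s v.2, Q.s v.1)
  form_add v u u' := by
    simp only [Prod.fst_add, Prod.snd_add, mul_add, map_add]; ring
  form_smul v a u := by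
    simp only [Prod.smul_fst, Prod.smul_snd, Ideal.Quotient.smul_eq_mk_mul]
    rw [mul_left_comm, mul_left_comm (Q.st v.2), map_mul Q.s, Q.s_C, Q.l_C_mul, Q.l_C_mul,
      mul_add]
  form_symm v u := by
    rw [map_add, ← Q.l_st_s, ← Q.l_st_s, Q.s_s, ← Q.s_st, map_mul Q.st, map_mul Q.st, Q.st_st,
      Q.st_st, add_comm, mul_comm v.2, mul_comm v.1]
  nondeg u hu := by
    refine Prod.ext ?_ (Q.l_nondeg _ fun v => ?_)
    · have h1 : Q.s u.1 = 0 := Q.l_nondeg _ fun v => by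
        have h2 := hu (0, Q.st (Q.s v))
        simpa only [map_zero, zero_mul, zero_add, Q.st_st, map_mul, Q.s_s] using h2
      have h3 := congrArg Q.s h1
      rwa [Q.s_s, map_zero] at h3
    · simpa [Q.st_st] using hu (Q.st v, 0)
  form_X v u := by
    simp only [Prod.smul_fst, Prod.smul_snd, Ideal.Quotient.smul_eq_mk_mul]
    have h : ∀ a b, Q.st (Ideal.Quotient.mk _ X * a) * (Ideal.Quotient.mk _ X * b) = Q.st a * b :=
      fun a b => by
        rw [map_mul, Q.st_t]; linear_combination Q.st a * b * Q.t_mul_ti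
    rw [h, h]
  inv_add v u := by simp only [Prod.fst_add, Prod.snd_add, map_add, Prod.mk_add_mk]
  inv_smul a v := by
    have h : ∀ v : K[X] ⧸ Ideal.span {F}, Q.s ((C a : K[X]) • v) = (C a : K[X]) • Q.s v :=
      fun v => by
        simp only [Ideal.Quotient.smul_eq_mk_mul]
        rw [map_mul, Q.s_C]
    simp only [Prod.smul_fst, Prod.smul_snd, Prod.smul_mk, h]
  inv_inv v := by simp only [Q.s_s]
  X_smul_inv v := by
    have h : ∀ v : K[X] ⧸ Ideal.span {F}, (X : K[X]) • Q.s ((X : K[X]) • v) = Q.s v :=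
      fun v => by
        simp only [Ideal.Quotient.smul_eq_mk_mul]
        rw [map_mul, Q.s_t, ← mul_assoc, Q.t_mul_ti, one_mul]
    simp only [Prod.smul_fst, Prod.smul_snd, Prod.smul_mk, h]
  form_inv v u := by
    rw [← Q.s_st, ← Q.s_st, ← map_mul Q.s, ← map_mul Q.s, Q.s_s, add_comm]

end SelfReciprocalQuotient

/-- For odd degree `d` the terms of index `i` and `d - i` cancel at `-1`. -/
theorem Polynomial.natDegree_even_of_reverse_eq {K : Type*} [Field K] {F : K[X]}
    (h : F.reverse = F) (h1 : F.eval (-1) ≠ 0) : Even F.natDegree := by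
  by_contra hodd
  rw [Nat.not_even_iff_odd] at hodd
  refine h1 ?_
  rw [eval_eq_sum_range]
  have hpow : ∀ i ≤ F.natDegree, (-1 : K) ^ (F.natDegree - i) = -(-1) ^ i := fun i hi => by
    have h2 : (-1 : K) ^ (F.natDegree - i) * (-1) ^ i = -1 := by
      rw [← pow_add, Nat.sub_add_cancel hi, hodd.neg_one_pow]
    have h3 : (-1 : K) ^ i * (-1) ^ i = 1 := by rw [← mul_pow]; simp
    linear_combination (-1) ^ i * h2 - (-1) ^ (F.natDegree - i) * h3
  refine Finset.sum_involution (fun i _ => F.natDegree - i) (fun i hi => ?_) (fun i hi _ => ?_)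
    (fun i hi => ?_) (fun i hi => ?_)
  · have hi' : i ≤ F.natDegree := Nat.lt_succ_iff.mp (Finset.mem_range.mp hi)
    have h2 := coeff_reverse F i
    rw [h, revAt_le hi'] at h2
    rw [hpow i hi', ← h2]; ring
  · rintro h2
    have hi' : i ≤ F.natDegree := Nat.lt_succ_iff.mp (Finset.mem_range.mp hi)
    exact (Nat.not_even_iff_odd.mpr hodd) ⟨i, by omega⟩
  · exact Finset.mem_range.mpr (by omega)
  · have hi' : i ≤ F.natDegree := Nat.lt_succ_iff.mp (Finset.mem_range.mp hi)
    omega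

/-! ### Units solving `w = -ε s(w) t^(d-2)` -/

namespace SelfReciprocalQuotient

variable {K : Type*} [Field K] {σ : K →+* K} {F : K[X]} {ε : K}

theorem isUnit_t (Q : SelfReciprocalQuotient σ F ε) :
    IsUnit (Ideal.Quotient.mk (Ideal.span {F}) X) :=
  IsUnit.of_mul_eq_one _ Q.t_mul_ti

theorem isUnit_ti (Q : SelfReciprocalQuotient σ F ε) : IsUnit Q.ti :=
  IsUnit.of_mul_eq_one _ ((mul_comm _ _).trans Q.t_mul_ti)

theorem _root_.Ideal.Quotient.isUnit_mk_of_isCoprime {R : Type*} [CommRing R] {F g : R}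
    (h : IsCoprime F g) : IsUnit (Ideal.Quotient.mk (Ideal.span {F}) g) := by
  obtain ⟨a, b, hab⟩ := h
  refine IsUnit.of_mul_eq_one (Ideal.Quotient.mk _ b) ?_
  rw [← map_mul, ← map_one (Ideal.Quotient.mk _), Ideal.Quotient.eq, Ideal.mem_span_singleton]
  exact ⟨-a, by linear_combination hab⟩

/-- With `d = 2m`, the solution is `w = t^m - t^(m-2) = t^(m-2)(t² - 1)`, a unit by coprimality. -/
theorem nonempty_of_isCoprime (Q : SelfReciprocalQuotient σ F 1) (hd : Even F.natDegree)
    (hF : IsCoprime F (X ^ 2 - 1)) :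
    Nonempty (ReversibleHermitianStructure σ (K[X] ⧸ Ideal.span {F})) := by
  obtain ⟨m, hm⟩ := hd
  have htm : Ideal.Quotient.mk (Ideal.span {F}) X ^ m * Q.ti ^ m = 1 := by
    rw [← mul_pow, Q.t_mul_ti, one_pow]
  have ht := Q.t_mul_ti
  refine ⟨Q.rankOne (w := Ideal.Quotient.mk _ X ^ m - Ideal.Quotient.mk _ X ^ m * Q.ti ^ 2)
    ?_ ?_ ?_⟩
  · have h1 := Ideal.Quotient.isUnit_mk_of_isCoprime hF
    have h2 := ((Q.isUnit_t.pow m).mul (Q.isUnit_ti.pow 2)).mul h1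
    convert h2 using 1
    rw [map_sub, map_pow, map_one]
    linear_combination -Ideal.Quotient.mk (Ideal.span {F}) X ^ m *
      (Ideal.Quotient.mk (Ideal.span {F}) X * Q.ti + 1) * ht
  · simp only [map_sub, map_mul, map_pow, Q.s_t, Q.st_t, Q.s_ti, Q.st_ti]
  · simp only [map_sub, map_mul, map_pow, Q.s_t, Q.s_ti, hm, map_one, pow_add]
    generalize Ideal.Quotient.mk (Ideal.span {F}) X = t at *
    linear_combination t ^ m * Q.ti ^ 2 * (1 - t ^ 2) * htm - t ^ m * (t * Q.ti + 1) * ht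

/-- The sign disappears in characteristic 2, so the monomial `t^(m-1)`, always a unit, solves the
equation for `d = 2m`. -/
theorem nonempty_of_two_eq_zero (Q : SelfReciprocalQuotient σ F 1) (hd : Even F.natDegree)
    (h2 : (2 : K) = 0) :
    Nonempty (ReversibleHermitianStructure σ (K[X] ⧸ Ideal.span {F})) := by
  obtain ⟨m, hm⟩ := hd
  have htm : Ideal.Quotient.mk (Ideal.span {F}) X ^ m * Q.ti ^ m = 1 := by
    rw [← mul_pow, Q.t_mul_ti, one_pow]
  have h2' : (2 : K[X] ⧸ Ideal.span {F}) = 0 := by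
    have := congrArg (fun a => Ideal.Quotient.mk (Ideal.span {F}) (C a)) h2
    simpa only [map_ofNat, map_zero] using this
  refine ⟨Q.rankOne (w := Ideal.Quotient.mk _ X ^ m * Q.ti)
    ((Q.isUnit_t.pow m).mul Q.isUnit_ti) ?_ ?_⟩
  · simp only [map_mul, map_pow, Q.s_t, Q.st_t, Q.s_ti, Q.st_ti]
  · simp only [map_mul, map_pow, Q.s_t, Q.s_ti, hm, map_one, pow_add]
    have ht := Q.t_mul_ti
    generalize Ideal.Quotient.mk (Ideal.span {F}) X = t at *
    linear_combination t ^ m * Q.ti * h2' + t ^ m * t * Q.ti ^ 2 * htm + t ^ m * Q.ti * ht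

/-- With `d = 2m + 1`, the solution is `w = t^m - ε t^(m-1) = t^(m-1)(t - ε)`. -/
theorem nonempty_of_odd (Q : SelfReciprocalQuotient σ F ε) (hd : Odd F.natDegree)
    (hε : ε * ε = 1) (hσ : σ ε = ε) (hF : IsCoprime F (X - C ε)) :
    Nonempty (ReversibleHermitianStructure σ (K[X] ⧸ Ideal.span {F})) := by
  obtain ⟨m, hm⟩ := hd
  have htm : Ideal.Quotient.mk (Ideal.span {F}) X ^ m * Q.ti ^ m = 1 := by
    rw [← mul_pow, Q.t_mul_ti, one_pow]
  have he : Ideal.Quotient.mk (Ideal.span {F}) (C ε) * Ideal.Quotient.mk _ (C ε) = 1 := by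
    rw [← map_mul, ← map_mul, hε, map_one, map_one]
  have ht := Q.t_mul_ti
  refine ⟨Q.rankOne (w := Ideal.Quotient.mk _ X ^ m -
    Ideal.Quotient.mk _ (C ε) * Ideal.Quotient.mk _ X ^ m * Q.ti) ?_ ?_ ?_⟩
  · have h1 := Ideal.Quotient.isUnit_mk_of_isCoprime hF
    have h2 := ((Q.isUnit_t.pow m).mul Q.isUnit_ti).mul h1
    convert h2 using 1
    rw [map_sub]
    linear_combination -Ideal.Quotient.mk (Ideal.span {F}) X ^ m * ht
  · simp only [map_sub, map_mul, map_pow, Q.s_t, Q.st_t, Q.s_ti, Q.st_ti, Q.s_C, Q.st_C, hσ]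
  · simp only [map_sub, map_mul, map_pow, Q.s_t, Q.s_ti, Q.s_C, hm, pow_add, pow_mul, pow_one]
    generalize Ideal.Quotient.mk (Ideal.span {F}) X = t at *
    generalize Ideal.Quotient.mk (Ideal.span {F}) (C ε) = e at *
    linear_combination (e * t ^ m * t * Q.ti ^ 2 - e ^ 2 * t ^ m * t ^ 2 * Q.ti ^ 2) * htm
      + (e * t ^ m * Q.ti - t ^ m * (t * Q.ti + 1)) * ht - t ^ m * (t * Q.ti) ^ 2 * he

end SelfReciprocalQuotient

/-! ### Monic reciprocals and powers of irreducible polynomials -/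

namespace Polynomial

variable {K : Type*} [Field K]

/-- The monic reciprocal of a polynomial with nonzero constant term. -/
noncomputable def recip (P : K[X]) : K[X] := C (P.coeff 0)⁻¹ * P.reverse

theorem natTrailingDegree_eq_zero_of_coeff_zero_ne_zero {P : K[X]} (h : P.coeff 0 ≠ 0) :
    P.natTrailingDegree = 0 :=
  natTrailingDegree_eq_zero.mpr (Or.inr h)

theorem reverse_reverse_of_coeff_zero_ne_zero {P : K[X]} (h : P.coeff 0 ≠ 0) :
    P.reverse.reverse = P := by
  have h1 : P.mirror = P.reverse := by
    rw [mirror, natTrailingDegree_eq_zero_of_coeff_zero_ne_zero h, pow_zero, mul_one]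
  have h2 : P.reverse.mirror = P.reverse.reverse := by
    rw [mirror, natTrailingDegree_reverse, pow_zero, mul_one]
  rw [← h2, ← h1, mirror_mirror]

theorem natDegree_reverse_of_coeff_zero_ne_zero {P : K[X]} (h : P.coeff 0 ≠ 0) :
    P.reverse.natDegree = P.natDegree := by
  rw [reverse_natDegree, natTrailingDegree_eq_zero_of_coeff_zero_ne_zero h, Nat.sub_zero]

theorem reverse_eq_C_mul_recip {P : K[X]} (h : P.coeff 0 ≠ 0) :
    P.reverse = C (P.coeff 0) * P.recip := by
  rw [recip, ← mul_assoc, ← C_mul, mul_inv_cancel₀ h, C_1, one_mul]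

theorem coeff_zero_recip {P : K[X]} (hP : P.Monic) : P.recip.coeff 0 = (P.coeff 0)⁻¹ := by
  rw [recip, coeff_C_mul, coeff_zero_reverse, hP.leadingCoeff, mul_one]

theorem coeff_zero_recip_ne_zero {P : K[X]} (hP : P.Monic) (h : P.coeff 0 ≠ 0) :
    P.recip.coeff 0 ≠ 0 := by
  rw [coeff_zero_recip hP]
  exact inv_ne_zero h

theorem natDegree_recip {P : K[X]} (h : P.coeff 0 ≠ 0) : P.recip.natDegree = P.natDegree := by
  rw [recip, natDegree_C_mul (inv_ne_zero h), natDegree_reverse_of_coeff_zero_ne_zero h]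

theorem monic_recip {P : K[X]} (h : P.coeff 0 ≠ 0) : P.recip.Monic := by
  rw [Monic, recip, leadingCoeff_mul, leadingCoeff_C, reverse_leadingCoeff, trailingCoeff,
    natTrailingDegree_eq_zero_of_coeff_zero_ne_zero h, inv_mul_cancel₀ h]

theorem recip_mul (P Q : K[X]) : (P * Q).recip = P.recip * Q.recip := by
  rw [recip, recip, recip, reverse_mul_of_domain, mul_coeff_zero, mul_inv, C_mul]
  ring

theorem recip_one : (1 : K[X]).recip = 1 := by
  rw [recip, ← C_1, reverse_C, coeff_C_zero, ← C_mul, inv_one, one_mul]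

theorem recip_pow (P : K[X]) (k : ℕ) : (P ^ k).recip = P.recip ^ k := by
  induction k with
  | zero => rw [pow_zero, pow_zero, recip_one]
  | succ k ih => rw [pow_succ, recip_mul, ih, pow_succ]

theorem recip_prod {ι : Type*} (s : Finset ι) (f : ι → K[X]) :
    (∏ i ∈ s, f i).recip = ∏ i ∈ s, (f i).recip := by
  classical
  induction s using Finset.induction_on with
  | empty => rw [Finset.prod_empty, Finset.prod_empty, recip_one]
  | insert a s ha ih => rw [Finset.prod_insert ha, Finset.prod_insert ha, recip_mul, ih]

theorem recip_recip {P : K[X]} (hP : P.Monic) (h : P.coeff 0 ≠ 0) : P.recip.recip = P := by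
  have h1 : (C (P.coeff 0)⁻¹ * P.reverse).reverse = C (P.coeff 0)⁻¹ * P := by
    rw [reverse_mul_of_domain, reverse_C, reverse_reverse_of_coeff_zero_ne_zero h]
  rw [recip, coeff_zero_recip hP, inv_inv, recip, h1, ← mul_assoc, ← C_mul, mul_inv_cancel₀ h,
    C_1, one_mul]

theorem isUnit_of_isUnit_reverse {a : K[X]} (h : a.coeff 0 ≠ 0) (ha : IsUnit a.reverse) :
    IsUnit a := by
  rw [isUnit_iff_degree_eq_zero, degree_eq_natDegree (by rintro rfl; simp at h),
    ← natDegree_reverse_of_coeff_zero_ne_zero h, natDegree_eq_zero_of_isUnit ha, Nat.cast_zero]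

theorem irreducible_recip {P : K[X]} (h : P.coeff 0 ≠ 0) (hP : Irreducible P) :
    Irreducible P.recip := by
  have hr : Irreducible P.reverse := by
    refine ⟨fun hu => hP.not_isUnit (isUnit_of_isUnit_reverse h hu), fun {a b} hab => ?_⟩
    have h0 : P.reverse.coeff 0 ≠ 0 := by
      rw [coeff_zero_reverse, leadingCoeff_ne_zero]; exact hP.ne_zero
    rw [hab, mul_coeff_zero] at h0
    have h1 := congrArg reverse hab
    rw [reverse_reverse_of_coeff_zero_ne_zero h, reverse_mul_of_domain] at h1
    exact (hP.isUnit_or_isUnit h1).imp (isUnit_of_isUnit_reverse (left_ne_zero_of_mul h0))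
      (isUnit_of_isUnit_reverse (right_ne_zero_of_mul h0))
  rw [recip, mul_comm]
  exact (irreducible_mul_isUnit (isUnit_C.mpr (inv_ne_zero h).isUnit)).mpr hr

theorem reverse_map (σ : K →+* K) (P : K[X]) : (P.map σ).reverse = P.reverse.map σ := by
  ext i
  rw [coeff_reverse, coeff_map, coeff_map, coeff_reverse, natDegree_map]

theorem recip_map (σ : K →+* K) (P : K[X]) : (P.map σ).recip = P.recip.map σ := by
  rw [recip, recip, reverse_map, Polynomial.map_mul, map_C, coeff_map, map_inv₀ σ]

theorem map_map_of_involutive {σ : K →+* K} (hσ : ∀ a, σ (σ a) = a) (P : K[X]) :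
    (P.map σ).map σ = P := by
  ext i; rw [coeff_map, coeff_map, hσ]

theorem irreducible_map_of_involutive {σ : K →+* K} (hσ : ∀ a, σ (σ a) = a) {P : K[X]}
    (hP : Irreducible P) : Irreducible (P.map σ) := by
  have h : ∀ a : K[X], IsUnit (a.map σ) → IsUnit a := fun a ha => by
    rw [← map_map_of_involutive hσ a]
    exact ha.map (mapRingHom σ)
  refine ⟨fun hu => hP.not_isUnit (h _ hu), fun {a b} hab => ?_⟩
  have h1 := congrArg (Polynomial.map σ) hab
  rw [map_map_of_involutive hσ, Polynomial.map_mul] at h1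
  refine (hP.isUnit_or_isUnit h1).imp (h _) (h _)

theorem pow_eq_pow_iff_of_irreducible {P Q : K[X]} (hP : P.Monic) (hPi : Irreducible P)
    (hQ : Q.Monic) (hQi : Irreducible Q) {j k : ℕ} (hj : 0 < j) :
    P ^ j = Q ^ k ↔ P = Q ∧ j = k := by
  refine ⟨fun h => ?_, by rintro ⟨rfl, rfl⟩; rfl⟩
  have h1 : P ∣ Q := hPi.prime.dvd_of_dvd_pow (h ▸ dvd_pow_self P hj.ne')
  have h2 : P = Q := eq_of_monic_of_associated hP hQ (hPi.associated_of_dvd hQi h1)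
  subst h2
  have h3 := congrArg natDegree h
  rw [natDegree_pow, natDegree_pow] at h3
  exact ⟨rfl, Nat.eq_of_mul_eq_mul_right hPi.natDegree_pos h3⟩

theorem recip_X_sub_C {a : K} (ha : a * a = 1) : (X - C a).recip = X - C a := by
  have ha0 : a ≠ 0 := by rintro rfl; simp at ha
  have h1 : (X - C a).reverse = 1 - C a * X := by
    ext i
    rw [coeff_reverse, natDegree_X_sub_C]
    rcases i with _ | _ | i
    · simp [revAt_le]
    · simp [revAt_le, coeff_one]
    · rw [revAt_eq_self_of_lt (by omega)]
      simp [coeff_X, coeff_one]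
  have h2 : ((X - C a).coeff 0)⁻¹ = -a := by
    rw [coeff_sub, coeff_X_zero, coeff_C_zero, zero_sub, inv_neg, neg_inj]
    exact inv_eq_of_mul_eq_one_left ha
  rw [recip, h1, h2, C_neg]
  have h3 : (C a : K[X]) * C a = 1 := by rw [← C_mul, ha, C_1]
  linear_combination X * h3

end Polynomial

/-! ### Cyclic modules attached to reciprocal orbits -/

section Cyclic

variable {K : Type*} [Field K] {σ : K →+* K}

theorem selfReciprocalQuotient_of_recip_eq (hσσ : ∀ a, σ (σ a) = a) {F : K[X]} (hF : F.Monic)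
    (h0 : F.coeff 0 ≠ 0) (hd : 0 < F.natDegree) (hσ : F.map σ = F) (hr : F.recip = F) :
    Nonempty (SelfReciprocalQuotient σ F (F.coeff 0)) := by
  refine SelfReciprocalQuotient.nonempty σ hσσ hF hd hσ ?_
  have h := reverse_eq_C_mul_recip h0
  rwa [hr] at h

/-- Evaluating `F.reverse = εF` at `1` gives `ε = 1`, as `F(1) ≠ 0`; then `F(-1) ≠ 0` makes the
degree even, and `F` is coprime to `X² - 1`. -/
theorem nonempty_structure_of_eval_ne_zero (hσσ : ∀ a, σ (σ a) = a) {F : K[X]} (hF : F.Monic)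
    (h0 : F.coeff 0 ≠ 0) (hd : 0 < F.natDegree) (hσ : F.map σ = F) (hr : F.recip = F)
    (h1 : F.eval 1 ≠ 0) (h2 : F.eval (-1) ≠ 0) :
    Nonempty (ReversibleHermitianStructure σ (K[X] ⧸ Ideal.span {F})) := by
  obtain ⟨Q⟩ := selfReciprocalQuotient_of_recip_eq hσσ hF h0 hd hσ hr
  have hrev := reverse_eq_C_mul_recip h0
  rw [hr] at hrev
  have hc : F.coeff 0 = 1 := by
    let : Invertible (1 : K) := invertibleOne
    have h3 := eval₂_reverse_mul_pow (RingHom.id K) 1 F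
    rw [one_pow, mul_one, invOf_one, hrev, eval₂_mul, eval₂_C, RingHom.id_apply] at h3
    exact mul_right_cancel₀ h1 (h3.trans (one_mul _).symm)
  rw [hc] at Q
  rw [hc, C_1, one_mul] at hrev
  refine Q.nonempty_of_isCoprime (natDegree_even_of_reverse_eq hrev h2) ?_
  have hcop : ∀ a, F.eval a ≠ 0 → IsCoprime F (X - C a) := fun a ha =>
    ((irreducible_X_sub_C a).coprime_iff_not_dvd.mpr fun h => ha (dvd_iff_isRoot.mp h)).symm
  have h4 : (X ^ 2 - 1 : K[X]) = (X - C 1) * (X - C (-1)) := by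
    rw [C_neg, C_1]; ring
  rw [h4]
  exact (hcop 1 h1).mul_right (hcop (-1) h2)

theorem nonempty_selfReciprocalQuotient_X_sub_C_pow (hσσ : ∀ a, σ (σ a) = a) {a : K}
    (ha : a * a = 1) (hσa : σ a = a) {k : ℕ} (hk : 0 < k) :
    Nonempty (SelfReciprocalQuotient σ ((X - C a) ^ k) ((-a) ^ k)) := by
  have ha0 : a ≠ 0 := by rintro rfl; simp at ha
  have hc : ((X - C a) ^ k).coeff 0 = (-a) ^ k := by
    rw [coeff_zero_eq_eval_zero, eval_pow, eval_sub, eval_X, eval_C, zero_sub]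
  rw [← hc]
  refine selfReciprocalQuotient_of_recip_eq hσσ ((monic_X_sub_C a).pow k) ?_ ?_ ?_ ?_
  · rw [hc]; exact pow_ne_zero _ (neg_ne_zero.mpr ha0)
  · rwa [natDegree_pow, natDegree_X_sub_C, mul_one]
  · rw [Polynomial.map_pow, Polynomial.map_sub, map_X, map_C, hσa]
  · rw [recip_pow, recip_X_sub_C ha]

/-- In odd characteristic with `k` odd, `ε = (-a)^k = -a`, and `X - a` is coprime to `X + a` because
`2a ≠ 0`. In characteristic 2 with `k` even, `ε = 1`. -/
theorem nonempty_structure_X_sub_C_pow (hσσ : ∀ a, σ (σ a) = a) {a : K} (ha : a * a = 1)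
    (hσa : σ a = a) {k : ℕ} (hk : 0 < k)
    (hpar : (2 : K) ≠ 0 ∧ Odd k ∨ (2 : K) = 0 ∧ Even k) :
    Nonempty (ReversibleHermitianStructure σ (K[X] ⧸ Ideal.span {(X - C a) ^ k})) := by
  obtain ⟨Q⟩ := nonempty_selfReciprocalQuotient_X_sub_C_pow hσσ ha hσa hk
  have hdeg : ((X - C a) ^ k).natDegree = k := by rw [natDegree_pow, natDegree_X_sub_C, mul_one]
  have ha0 : a ≠ 0 := by rintro rfl; simp at ha
  rcases hpar with ⟨h2, hk'⟩ | ⟨h2, hk'⟩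
  · have hak : (-a) ^ k = -a := by
      obtain ⟨j, rfl⟩ := hk'
      rw [pow_add, pow_mul, neg_sq, sq, ha, one_pow, one_mul, pow_one]
    rw [hak] at Q
    refine Q.nonempty_of_odd (by rwa [hdeg]) (by rw [neg_mul_neg, ha]) (by rw [map_neg, hσa]) ?_
    refine (isCoprime_X_sub_C_of_isUnit_sub ?_).pow_left
    rw [sub_neg_eq_add, ← two_mul]
    exact (mul_ne_zero h2 ha0).isUnit
  · have hak : (-a) ^ k = 1 := by
      obtain ⟨j, rfl⟩ := hk'
      rw [pow_add, ← mul_pow, neg_mul_neg, ha, one_pow]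
    rw [hak] at Q
    exact Q.nonempty_of_two_eq_zero (by rwa [hdeg]) h2

/-- The orbit of a polynomial under `σ` and the passage to the monic reciprocal. -/
noncomputable def reciprocalOrbit (σ : K →+* K) (P : K[X]) : Finset K[X] :=
  open Classical in {P, P.recip, P.map σ, (P.map σ).recip}

theorem mem_reciprocalOrbit {P Q : K[X]} : Q ∈ reciprocalOrbit σ P ↔
    Q = P ∨ Q = P.recip ∨ Q = P.map σ ∨ Q = (P.map σ).recip := by
  simp [reciprocalOrbit]

theorem coeff_zero_map_ne_zero {P : K[X]} (h0 : P.coeff 0 ≠ 0) : (P.map σ).coeff 0 ≠ 0 := by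
  rwa [coeff_map, _root_.map_ne_zero]

theorem props_of_mem_reciprocalOrbit (hσσ : ∀ a, σ (σ a) = a) {P Q : K[X]} (hP : P.Monic)
    (hPi : Irreducible P) (h0 : P.coeff 0 ≠ 0) (hQ : Q ∈ reciprocalOrbit σ P) :
    Q.Monic ∧ Irreducible Q ∧ Q.coeff 0 ≠ 0 := by
  have h1 := coeff_zero_map_ne_zero (σ := σ) h0
  rcases mem_reciprocalOrbit.mp hQ with rfl | rfl | rfl | rfl
  · exact ⟨hP, hPi, h0⟩
  · exact ⟨monic_recip h0, irreducible_recip h0 hPi, coeff_zero_recip_ne_zero hP h0⟩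
  · exact ⟨hP.map σ, irreducible_map_of_involutive hσσ hPi, h1⟩
  · exact ⟨monic_recip h1, irreducible_recip h1 (irreducible_map_of_involutive hσσ hPi),
      coeff_zero_recip_ne_zero (hP.map σ) h1⟩

theorem recip_mem_reciprocalOrbit {P Q : K[X]} (hP : P.Monic) (h0 : P.coeff 0 ≠ 0)
    (hQ : Q ∈ reciprocalOrbit σ P) : Q.recip ∈ reciprocalOrbit σ P := by
  have h1 := coeff_zero_map_ne_zero (σ := σ) h0
  rw [mem_reciprocalOrbit] at hQ ⊢
  rcases hQ with rfl | rfl | rfl | rfl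
  · exact Or.inr (Or.inl rfl)
  · exact Or.inl (recip_recip hP h0)
  · exact Or.inr (Or.inr (Or.inr rfl))
  · exact Or.inr (Or.inr (Or.inl (recip_recip (hP.map σ) h1)))

theorem map_mem_reciprocalOrbit (hσσ : ∀ a, σ (σ a) = a) {P Q : K[X]}
    (hQ : Q ∈ reciprocalOrbit σ P) : Q.map σ ∈ reciprocalOrbit σ P := by
  rw [mem_reciprocalOrbit] at hQ ⊢
  rcases hQ with rfl | rfl | rfl | rfl
  · exact Or.inr (Or.inr (Or.inl rfl))
  · exact Or.inr (Or.inr (Or.inr (recip_map σ _).symm))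
  · exact Or.inl (map_map_of_involutive hσσ _)
  · refine Or.inr (Or.inl ?_)
    rw [← recip_map, map_map_of_involutive hσσ]

theorem eq_X_sub_C_of_mem_reciprocalOrbit (hσσ : ∀ a, σ (σ a) = a) {P : K[X]} (hP : P.Monic)
    (h0 : P.coeff 0 ≠ 0) {a : K} (ha : a * a = 1) (hσa : σ a = a)
    (h : X - C a ∈ reciprocalOrbit σ P) : P = X - C a := by
  have hm : ∀ Q : K[X], X - C a = Q.map σ → Q = X - C a := fun Q hQ => by
    rw [← map_map_of_involutive hσσ Q, ← hQ, Polynomial.map_sub, map_X, map_C, hσa]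
  have hr : ∀ Q : K[X], Q.Monic → Q.coeff 0 ≠ 0 → X - C a = Q.recip → Q = X - C a :=
    fun Q hQ hQ0 h => by rw [← recip_recip hQ hQ0, ← h, recip_X_sub_C ha]
  rcases mem_reciprocalOrbit.mp h with h | h | h | h
  · exact h.symm
  · exact hr P hP h0 h
  · exact hm P h
  · exact hm P (hr _ (hP.map σ) (coeff_zero_map_ne_zero h0) h).symm

theorem reciprocalOrbit_X_sub_C {a : K} (ha : a * a = 1) (hσa : σ a = a) :
    reciprocalOrbit σ (X - C a) = {X - C a} := by
  have h : (X - C a).map σ = X - C a := by rw [Polynomial.map_sub, map_X, map_C, hσa]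
  ext Q
  rw [mem_reciprocalOrbit, h, recip_X_sub_C ha, Finset.mem_singleton]
  tauto

theorem recip_prod_reciprocalOrbit (hσσ : ∀ a, σ (σ a) = a) {P : K[X]} (hP : P.Monic)
    (hPi : Irreducible P) (h0 : P.coeff 0 ≠ 0) (k : ℕ) :
    (∏ Q ∈ reciprocalOrbit σ P, Q ^ k).recip = ∏ Q ∈ reciprocalOrbit σ P, Q ^ k := by
  have hinv : ∀ Q ∈ reciprocalOrbit σ P, Q.recip.recip = Q := fun Q hQ =>
    have h := props_of_mem_reciprocalOrbit hσσ hP hPi h0 hQ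
    recip_recip h.1 h.2.2
  rw [recip_prod]
  exact Finset.prod_nbij' recip recip (fun Q hQ => recip_mem_reciprocalOrbit hP h0 hQ)
    (fun Q hQ => recip_mem_reciprocalOrbit hP h0 hQ) hinv hinv fun Q _ => recip_pow Q k

theorem map_prod_reciprocalOrbit (hσσ : ∀ a, σ (σ a) = a) (P : K[X]) (k : ℕ) :
    (∏ Q ∈ reciprocalOrbit σ P, Q ^ k).map σ = ∏ Q ∈ reciprocalOrbit σ P, Q ^ k := by
  rw [Polynomial.map_prod]
  exact Finset.prod_nbij' (Polynomial.map σ) (Polynomial.map σ)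
    (fun Q hQ => map_mem_reciprocalOrbit hσσ hQ) (fun Q hQ => map_mem_reciprocalOrbit hσσ hQ)
    (fun Q _ => map_map_of_involutive hσσ Q) (fun Q _ => map_map_of_involutive hσσ Q)
    fun Q _ => Polynomial.map_pow σ k

/-- The orbit of `X ∓ 1` is a singleton, so any other orbit avoids it and its product does not
vanish at `±1`. -/
theorem nonempty_structure_prod_reciprocalOrbit (hσσ : ∀ a, σ (σ a) = a) {P : K[X]}
    (hP : P.Monic) (hPi : Irreducible P) (h0 : P.coeff 0 ≠ 0) {k : ℕ} (hk : 0 < k)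
    (h1 : P = X - C 1 ∨ P = X - C (-1) →
      (2 : K) ≠ 0 ∧ Odd k ∨ (2 : K) = 0 ∧ Even k) :
    Nonempty (ReversibleHermitianStructure σ
      (K[X] ⧸ Ideal.span {∏ Q ∈ reciprocalOrbit σ P, Q ^ k})) := by
  have hone : (1 : K) * 1 = 1 := one_mul 1
  have hneg : (-1 : K) * -1 = 1 := by ring
  have hσ1 : σ 1 = 1 := map_one σ
  have hσn : σ (-1) = -1 := by rw [map_neg, map_one]
  by_cases hX : P = X - C 1 ∨ P = X - C (-1)
  · have h2 := h1 hX
    rcases hX with rfl | rfl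
    · rw [reciprocalOrbit_X_sub_C hone hσ1, Finset.prod_singleton]
      exact nonempty_structure_X_sub_C_pow hσσ hone hσ1 hk h2
    · rw [reciprocalOrbit_X_sub_C hneg hσn, Finset.prod_singleton]
      exact nonempty_structure_X_sub_C_pow hσσ hneg hσn hk h2
  · push Not at hX
    have hpr := fun Q => props_of_mem_reciprocalOrbit (Q := Q) hσσ hP hPi h0
    have hmon : (∏ Q ∈ reciprocalOrbit σ P, Q ^ k).Monic :=
      monic_prod_of_monic _ _ fun Q hQ => (hpr Q hQ).1.pow k
    have hev : ∀ a : K, a * a = 1 → σ a = a → P ≠ X - C a →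
        (∏ Q ∈ reciprocalOrbit σ P, Q ^ k).eval a ≠ 0 := fun a ha hσa hPa => by
      rw [eval_prod, Finset.prod_ne_zero_iff]
      intro Q hQ
      rw [eval_pow]
      refine pow_ne_zero _ fun hr => hPa ?_
      have h3 : X - C a = Q := eq_of_monic_of_associated (monic_X_sub_C a) (hpr Q hQ).1
        ((irreducible_X_sub_C a).associated_of_dvd (hpr Q hQ).2.1 (dvd_iff_isRoot.mpr hr))
      exact eq_X_sub_C_of_mem_reciprocalOrbit hσσ hP h0 ha hσa (h3 ▸ hQ)
    refine nonempty_structure_of_eval_ne_zero hσσ hmon ?_ ?_ (map_prod_reciprocalOrbit hσσ P k)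
      (recip_prod_reciprocalOrbit hσσ hP hPi h0 k) (hev 1 hone hσ1 hX.1) (hev _ hneg hσn hX.2)
    · rw [coeff_zero_eq_eval_zero, eval_prod, Finset.prod_ne_zero_iff]
      intro Q hQ
      rw [eval_pow, ← coeff_zero_eq_eval_zero]
      exact pow_ne_zero _ (hpr Q hQ).2.2
    · have hPm : P ∈ reciprocalOrbit σ P := mem_reciprocalOrbit.mpr (Or.inl rfl)
      have hdvd : P ∣ ∏ Q ∈ reciprocalOrbit σ P, Q ^ k :=
        (dvd_pow_self P hk.ne').trans (Finset.dvd_prod_of_mem _ hPm)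
      exact hPi.natDegree_pos.trans_le (natDegree_le_of_dvd hdvd hmon.ne_zero)

end Cyclic

/-! ### Assembling the form along the elementary divisors -/

/-- Pieces are chosen by counting elementary divisors, while the summands are indexed; this turns a
submultiset of values into a set of indices. -/
theorem Multiset.exists_finset_map_eq_of_le {ι α : Type*} (d : ι → α) (u : Multiset α)
    (S : Finset ι) (h : u ≤ S.val.map d) : ∃ T ⊆ S, T.val.map d = u := by
  classical
  induction u using Multiset.induction_on generalizing S with
  | empty => exact ⟨∅, Finset.empty_subset S, rfl⟩
  | cons a u ih =>
    obtain ⟨i, hi, rfl⟩ := Multiset.mem_map.mp (Multiset.mem_of_le h (Multiset.mem_cons_self a u))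
    have hS : S.val = i ::ₘ (S.erase i).val := by
      rw [Finset.erase_val, Multiset.cons_erase hi]
    rw [hS, Multiset.map_cons, Multiset.cons_le_cons_iff] at h
    obtain ⟨T, hT, rfl⟩ := ih (S.erase i) h
    have hiT : i ∉ T := fun h => Finset.notMem_erase i S (hT h)
    refine ⟨insert i T, ?_, ?_⟩
    · exact Finset.insert_subset hi (hT.trans (Finset.erase_subset i S))
    · rw [Finset.insert_val_of_notMem hiT, Multiset.map_cons]

/-- The Chinese remainder theorem as an isomorphism of modules. -/
theorem Ideal.nonempty_quotient_prod_linearEquiv_pi {R ι : Type*} [CommRing R] [Fintype ι]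
    (g : ι → R) (hg : Pairwise (Function.onFun IsCoprime g)) :
    Nonempty ((R ⧸ Ideal.span {∏ i, g i}) ≃ₗ[R] ((i : ι) → R ⧸ Ideal.span {g i})) := by
  let f : R →ₗ[R] ((i : ι) → R ⧸ Ideal.span {g i}) :=
    LinearMap.pi fun i => (Ideal.span {g i}).mkQ
  have hf : Function.Surjective f := fun x => by
    obtain ⟨r, hr⟩ := Ideal.pi_quotient_surjective (I := fun i => Ideal.span {g i})
      (fun i j hij => (Ideal.isCoprime_span_singleton_iff _ _).mpr (hg hij)) x
    exact ⟨r, funext hr⟩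
  have hk : Ideal.span {∏ i, g i} = LinearMap.ker f := by
    ext x
    rw [Ideal.mem_span_singleton, LinearMap.mem_ker]
    constructor
    · intro h
      funext i
      change Ideal.Quotient.mk (Ideal.span {g i}) x = 0
      rw [Ideal.Quotient.eq_zero_iff_mem, Ideal.mem_span_singleton]
      exact (Finset.dvd_prod_of_mem g (Finset.mem_univ i)).trans h
    · intro h
      refine Fintype.prod_dvd_of_coprime hg fun i => ?_
      have h1 : Ideal.Quotient.mk (Ideal.span {g i}) x = 0 := congrFun h i
      rwa [Ideal.Quotient.eq_zero_iff_mem, Ideal.mem_span_singleton] at h1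
  exact ⟨(Submodule.quotEquivOfEq _ _ hk).trans (f.quotKerEquivOfSurjective hf)⟩

theorem Finset.nonempty_pi_linearEquiv_prod {R ι : Type*} [Ring R] [DecidableEq ι] (A : ι → Type*)
    [∀ i, AddCommGroup (A i)] [∀ i, Module R (A i)] {S T : Finset ι} (hT : T ⊆ S) :
    Nonempty (((i : S) → A i) ≃ₗ[R] ((i : T) → A i) × ((i : ↥(S \ T)) → A i)) := by
  let f : ((i : S) → A i) →ₗ[R] ((i : T) → A i) × ((i : ↥(S \ T)) → A i) :=
    LinearMap.prod (LinearMap.pi fun i => LinearMap.proj (⟨i, hT i.2⟩ : S))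
      (LinearMap.pi fun i => LinearMap.proj (⟨i, (Finset.mem_sdiff.mp i.2).1⟩ : S))
  refine ⟨LinearEquiv.ofBijective f ⟨fun v w h => ?_, fun v => ?_⟩⟩
  · obtain ⟨h1, h2⟩ := Prod.ext_iff.mp h
    funext ⟨i, hi⟩
    by_cases hiT : i ∈ T
    · exact congrFun h1 ⟨i, hiT⟩
    · exact congrFun h2 ⟨i, Finset.mem_sdiff.mpr ⟨hi, hiT⟩⟩
  · refine ⟨fun i => if h : i.1 ∈ T then v.1 ⟨i, h⟩ else v.2 ⟨i, Finset.mem_sdiff.mpr ⟨i.2, h⟩⟩,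
      Prod.ext (funext fun i => ?_) (funext fun i => ?_)⟩
    · exact dif_pos i.2
    · exact dif_neg (Finset.mem_sdiff.mp i.2).2

section Family

variable {K : Type*} [Field K] {σ : K →+* K}

theorem ReversibleHermitianStructure.nonempty_of_subsingleton {M : Type*} [AddCommGroup M]
    [Module K[X] M] [Subsingleton M] : Nonempty (ReversibleHermitianStructure σ M) :=
  ⟨{ form := fun _ _ => 0
     inv := id
     form_add := by simp
     form_smul := by simp
     form_symm := by simp
     nondeg := fun w _ => Subsingleton.elim _ _
     form_X := by simp
     inv_add := by simp
     inv_smul := by simp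
     inv_inv := by simp
     X_smul_inv := fun v => Subsingleton.elim _ _
     form_inv := by simp }⟩

/-- The conditions on a multiset of elementary divisors that allow a reversible Hermitian
structure. -/
def IsReciprocalStable (σ : K →+* K) (D : Multiset K[X]) : Prop :=
  open Classical in
  (∀ (P : K[X]) (k : ℕ), P.Monic → Irreducible P → P.coeff 0 ≠ 0 → 0 < k →
    D.count (P.recip ^ k) = D.count (P ^ k) ∧ D.count (P.map σ ^ k) = D.count (P ^ k)) ∧
  ∀ (a : K) (k : ℕ), a = 1 ∨ a = -1 → 0 < k →
    ¬ ((2 : K) ≠ 0 ∧ Odd k ∨ (2 : K) = 0 ∧ Even k) → Even (D.count ((X - C a) ^ k))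

theorem IsReciprocalStable.of_add {u D : Multiset K[X]} (h : IsReciprocalStable σ (u + D))
    (hu : IsReciprocalStable σ u) : IsReciprocalStable σ D := by
  classical
  refine ⟨fun P k h1 h2 h3 h4 => ?_, fun a k h1 h2 h3 => ?_⟩
  · obtain ⟨h5, h6⟩ := h.1 P k h1 h2 h3 h4
    obtain ⟨h7, h8⟩ := hu.1 P k h1 h2 h3 h4
    rw [Multiset.count_add, Multiset.count_add] at h5 h6
    exact ⟨by omega, by omega⟩
  · have h4 := h.2 a k h1 h2 h3
    rw [Multiset.count_add, Nat.even_add] at h4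
    exact h4.mp (hu.2 a k h1 h2 h3)

/-- `X - C a` is fixed by both operations, and two copies change no parity, so a hyperbolic pair can
be split off without leaving the stable multisets. -/
theorem isReciprocalStable_pair {a : K} (ha : a * a = 1) (hσa : σ a = a)
    (hσσ : ∀ a, σ (σ a) = a) {k : ℕ} :
    IsReciprocalStable σ (Multiset.replicate 2 ((X - C a) ^ k)) := by
  classical
  refine ⟨fun Q j h1 h2 h3 h4 => ?_, fun b j _ _ _ => ?_⟩
  · have hX := irreducible_X_sub_C a
    have hXm := monic_X_sub_C a
    have hiff : ∀ Q : K[X], Q.Monic → Irreducible Q →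
        ((X - C a) ^ k = Q ^ j ↔ Q = X - C a ∧ j = k) := fun Q hQ hQi => by
      rw [eq_comm, pow_eq_pow_iff_of_irreducible hQ hQi hXm hX h4]
    have hr : Q.recip = X - C a ↔ Q = X - C a := by
      constructor
      · intro h; rw [← recip_recip h1 h3, h, recip_X_sub_C ha]
      · rintro rfl; exact recip_X_sub_C ha
    have hXσ : (X - C a).map σ = X - C a := by rw [Polynomial.map_sub, map_X, map_C, hσa]
    have hm : Q.map σ = X - C a ↔ Q = X - C a := by
      constructor
      · intro h; rw [← map_map_of_involutive hσσ Q, h, hXσ]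
      · rintro rfl; exact hXσ
    simp only [Multiset.count_replicate, hiff Q h1 h2,
      hiff _ (monic_recip h3) (irreducible_recip h3 h2),
      hiff _ (h1.map σ) (irreducible_map_of_involutive hσσ h2), hr, hm, and_self]
  · rw [Multiset.count_replicate]
    split_ifs
    · exact even_two
    · exact Even.zero

/-- Distinct orbit members have distinct `k`-th powers, so counts are `0` or `1` according to
membership in the orbit, which both operations preserve. -/
theorem isReciprocalStable_reciprocalOrbit (hσσ : ∀ a, σ (σ a) = a) {P : K[X]} (hP : P.Monic)
    (hPi : Irreducible P) (h0 : P.coeff 0 ≠ 0) {k : ℕ} (hk : 0 < k)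
    (h1 : P = X - C 1 ∨ P = X - C (-1) →
      (2 : K) ≠ 0 ∧ Odd k ∨ (2 : K) = 0 ∧ Even k) :
    ((reciprocalOrbit σ P).val.map (· ^ k)).Nodup ∧
    IsReciprocalStable σ ((reciprocalOrbit σ P).val.map (· ^ k)) := by
  classical
  have hpr := fun Q => props_of_mem_reciprocalOrbit (Q := Q) hσσ hP hPi h0
  have hnodup : ((reciprocalOrbit σ P).val.map (· ^ k)).Nodup := by
    refine Multiset.Nodup.map_on (fun Q hQ R hR h => ?_) (Finset.nodup _)
    exact ((pow_eq_pow_iff_of_irreducible (hpr Q hQ).1 (hpr Q hQ).2.1 (hpr R hR).1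
      (hpr R hR).2.1 hk).mp h).1
  have hmem : ∀ (Q : K[X]) (j : ℕ), Q.Monic → Irreducible Q → 0 < j →
      (Q ^ j ∈ (reciprocalOrbit σ P).val.map (· ^ k) ↔ Q ∈ reciprocalOrbit σ P ∧ j = k) :=
    fun Q j hQ hQi hj => by
      rw [Multiset.mem_map]
      constructor
      · rintro ⟨R, hR, h⟩
        obtain ⟨rfl, rfl⟩ := (pow_eq_pow_iff_of_irreducible (hpr R hR).1 (hpr R hR).2.1 hQ hQi
          hk).mp h
        exact ⟨hR, rfl⟩
      · rintro ⟨hQ, rfl⟩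
        exact ⟨Q, hQ, rfl⟩
  refine ⟨hnodup, fun Q j h2 h3 h4 h5 => ?_, fun a j h2 h3 h4 => ?_⟩
  · have hr : Q.recip ∈ reciprocalOrbit σ P ↔ Q ∈ reciprocalOrbit σ P :=
      ⟨fun h => recip_recip h2 h4 ▸ recip_mem_reciprocalOrbit hP h0 h,
        recip_mem_reciprocalOrbit hP h0⟩
    have hm : Q.map σ ∈ reciprocalOrbit σ P ↔ Q ∈ reciprocalOrbit σ P :=
      ⟨fun h => map_map_of_involutive hσσ Q ▸ map_mem_reciprocalOrbit hσσ h,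
        map_mem_reciprocalOrbit hσσ⟩
    simp only [Multiset.count_eq_of_nodup hnodup, hmem Q j h2 h3 h5,
      hmem _ j (monic_recip h4) (irreducible_recip h4 h3) h5,
      hmem _ j (h2.map σ) (irreducible_map_of_involutive hσσ h3) h5, hr, hm, and_self]
  · have ha : a * a = 1 := by rcases h2 with rfl | rfl <;> ring
    have hσa : σ a = a := by
      rcases h2 with rfl | rfl
      · exact map_one σ
      · rw [map_neg, map_one]
    rw [Multiset.count_eq_zero_of_notMem]
    · exact Even.zero
    · rw [hmem _ j (monic_X_sub_C a) (irreducible_X_sub_C a) h3]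
      rintro ⟨h5, rfl⟩
      have h6 := eq_X_sub_C_of_mem_reciprocalOrbit hσσ hP h0 ha hσa h5
      refine h4 (h1 ?_)
      rcases h2 with rfl | rfl
      · exact Or.inl h6
      · exact Or.inr h6

/-- The structure on the direct sum of the quotients belonging to a reciprocal orbit. -/
theorem nonempty_structure_pi_reciprocalOrbit (hσσ : ∀ a, σ (σ a) = a) {P : K[X]}
    (hP : P.Monic) (hPi : Irreducible P) (h0 : P.coeff 0 ≠ 0) {k : ℕ} (hk : 0 < k)
    (h1 : P = X - C 1 ∨ P = X - C (-1) →
      (2 : K) ≠ 0 ∧ Odd k ∨ (2 : K) = 0 ∧ Even k)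
    {ι : Type*} (d : ι → K[X]) (T : Finset ι)
    (hT : T.val.map d = (reciprocalOrbit σ P).val.map (· ^ k)) :
    Nonempty (ReversibleHermitianStructure σ ((i : T) → K[X] ⧸ Ideal.span {d i})) := by
  have hpr := fun Q => props_of_mem_reciprocalOrbit (Q := Q) hσσ hP hPi h0
  obtain ⟨S⟩ := nonempty_structure_prod_reciprocalOrbit hσσ hP hPi h0 hk h1
  have hprod : ∏ i : T, d i = ∏ Q ∈ reciprocalOrbit σ P, Q ^ k := by
    rw [Finset.prod_coe_sort, Finset.prod, hT]
    rfl
  have hnodup := (isReciprocalStable_reciprocalOrbit hσσ hP hPi h0 hk h1).1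
  rw [← hT] at hnodup
  have hd : ∀ i ∈ T, ∃ Q ∈ reciprocalOrbit σ P, Q ^ k = d i := fun i hi => by
    have h2 : d i ∈ T.val.map d := Multiset.mem_map_of_mem d hi
    rw [hT] at h2
    exact Multiset.mem_map.mp h2
  obtain ⟨e⟩ := Ideal.nonempty_quotient_prod_linearEquiv_pi (fun i : T => d i) (by
    rintro ⟨i, hi⟩ ⟨j, hj⟩ hij
    obtain ⟨Q, hQ, hQi⟩ := hd i hi
    obtain ⟨R, hR, hRj⟩ := hd j hj
    change IsCoprime (d i) (d j)
    rw [← hQi, ← hRj]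
    refine IsCoprime.pow ?_
    rw [(hpr Q hQ).2.1.coprime_iff_not_dvd]
    intro hdvd
    have h2 : Q = R := eq_of_monic_of_associated (hpr Q hQ).1 (hpr R hR).1
      ((hpr Q hQ).2.1.associated_of_dvd (hpr R hR).2.1 hdvd)
    refine hij (Subtype.ext (Multiset.inj_on_of_nodup_map hnodup i hi j hj ?_))
    rw [← hQi, ← hRj, h2])
  rw [hprod] at e
  exact ⟨S.congr e.symm⟩

/-- The structure on the direct sum of two copies of a quotient by a power of `X ± 1`. -/
theorem nonempty_structure_pi_pair (hσσ : ∀ a, σ (σ a) = a) {a : K} (ha : a * a = 1)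
    (hσa : σ a = a) {k : ℕ} (hk : 0 < k) {ι : Type*} (d : ι → K[X]) (T : Finset ι)
    (hT : T.val.map d = Multiset.replicate 2 ((X - C a) ^ k)) :
    Nonempty (ReversibleHermitianStructure σ ((i : T) → K[X] ⧸ Ideal.span {d i})) := by
  obtain ⟨Q⟩ := nonempty_selfReciprocalQuotient_X_sub_C_pow hσσ ha hσa hk
  have hd : ∀ i : T, d i = (X - C a) ^ k := fun i => by
    have h2 : d i ∈ T.val.map d := Multiset.mem_map_of_mem d i.2
    rw [hT] at h2
    exact Multiset.eq_of_mem_replicate h2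
  have hcard : T.card = 2 := by
    have h2 := congrArg Multiset.card hT
    rwa [Multiset.card_map, Multiset.card_replicate] at h2
  let e1 : ((i : T) → K[X] ⧸ Ideal.span {d i}) ≃ₗ[K[X]]
      (T → K[X] ⧸ Ideal.span {(X - C a) ^ k}) :=
    LinearEquiv.piCongrRight fun i => Submodule.quotEquivOfEq _ _ (by rw [hd i])
  let e2 : (T → K[X] ⧸ Ideal.span {(X - C a) ^ k}) ≃ₗ[K[X]]
      (Fin 2 → K[X] ⧸ Ideal.span {(X - C a) ^ k}) :=
    LinearEquiv.funCongrLeft K[X] _ (T.equivFinOfCardEq hcard).symm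
  exact ⟨Q.hyperbolic.congr ((e1.trans e2).trans (LinearEquiv.finTwoArrow K[X] _))⟩

/-- A direct sum of primary cyclic modules whose elementary divisors are stable under the passage
to reciprocals and under `σ` carries a reversible Hermitian structure. -/
theorem IsReciprocalStable.nonempty_structure (hσσ : ∀ a, σ (σ a) = a) {ι : Type*}
    (d : ι → K[X]) (S : Finset ι)
    (hd : ∀ i ∈ S, ∃ (P : K[X]) (k : ℕ), P.Monic ∧ Irreducible P ∧ P.coeff 0 ≠ 0 ∧ 0 < k ∧
      d i = P ^ k)
    (hS : IsReciprocalStable σ (S.val.map d)) :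
    Nonempty (ReversibleHermitianStructure σ ((i : S) → K[X] ⧸ Ideal.span {d i})) := by
  classical
  induction S using Finset.strongInduction with
  | H S ih =>
    rcases S.eq_empty_or_nonempty with rfl | ⟨i, hi⟩
    · exact ReversibleHermitianStructure.nonempty_of_subsingleton
    -- `u` is the piece to split off around `d i = P ^ k`: the powers over the orbit of `P`, or two
    -- copies of `(X ∓ 1) ^ k` when its parity is the exceptional one.
    · obtain ⟨u, hu0, huS, hus, hu⟩ : ∃ u : Multiset K[X], u ≠ 0 ∧ u ≤ S.val.map d ∧
          IsReciprocalStable σ u ∧ ∀ T : Finset ι, T.val.map d = u →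
          Nonempty (ReversibleHermitianStructure σ ((i : T) → K[X] ⧸ Ideal.span {d i})) := by
        obtain ⟨P, k, hP, hPi, h0, hk, hdi⟩ := hd i hi
        have hmem : P ^ k ∈ S.val.map d := hdi ▸ Multiset.mem_map_of_mem d hi
        by_cases h1 : P = X - C 1 ∨ P = X - C (-1) →
            (2 : K) ≠ 0 ∧ Odd k ∨ (2 : K) = 0 ∧ Even k
        · have hO := isReciprocalStable_reciprocalOrbit hσσ hP hPi h0 hk h1
          refine ⟨_, ?_, ?_, hO.2,
            fun T hT => nonempty_structure_pi_reciprocalOrbit hσσ hP hPi h0 hk h1 d T hT⟩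
          · intro h
            have h2 : P ^ k ∈ (reciprocalOrbit σ P).val.map (· ^ k) :=
              Multiset.mem_map_of_mem (· ^ k) (mem_reciprocalOrbit.mpr (Or.inl rfl))
            rw [h] at h2
            exact Multiset.notMem_zero _ h2
          · rw [Multiset.le_iff_subset hO.1]
            intro x hx
            obtain ⟨Q, hQ, rfl⟩ := Multiset.mem_map.mp hx
            have h2 := hS.1 P k hP hPi h0 hk
            have h3 := hS.1 (P.map σ) k (hP.map σ) (irreducible_map_of_involutive hσσ hPi)
              (coeff_zero_map_ne_zero h0) hk
            rw [← Multiset.count_pos] at hmem ⊢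
            rcases mem_reciprocalOrbit.mp hQ with rfl | rfl | rfl | rfl <;> omega
        · rw [Classical.not_imp] at h1
          obtain ⟨h1, h2⟩ := h1
          obtain ⟨a, ha, rfl⟩ : ∃ a : K, (a = 1 ∨ a = -1) ∧ P = X - C a := by
            rcases h1 with h | h
            · exact ⟨1, Or.inl rfl, h⟩
            · exact ⟨-1, Or.inr rfl, h⟩
          have haa : a * a = 1 := by rcases ha with rfl | rfl <;> ring
          have hσa : σ a = a := by
            rcases ha with rfl | rfl
            · exact map_one σ
            · rw [map_neg, map_one]
          refine ⟨Multiset.replicate 2 ((X - C a) ^ k), ?_, ?_,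
            isReciprocalStable_pair haa hσa hσσ,
            fun T hT => nonempty_structure_pi_pair hσσ haa hσa hk d T hT⟩
          · intro h
            have := congrArg Multiset.card h
            simp at this
          · rw [← Multiset.le_count_iff_replicate_le]
            rw [← Multiset.count_pos] at hmem
            -- An even positive count is at least `2`.
            obtain ⟨c, hc⟩ := hS.2 a k ha hk h2
            omega
      obtain ⟨T, hTS, hTu⟩ := Multiset.exists_finset_map_eq_of_le d u S huS
      have hsum : u + (S \ T).val.map d = S.val.map d := by
        rw [← hTu, ← Multiset.map_add, Finset.sdiff_val, add_comm,
          Multiset.sub_add_cancel (Finset.val_le_iff.mpr hTS)]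
      have hTne : T.Nonempty := by
        rw [Finset.nonempty_iff_ne_empty]
        rintro rfl
        exact hu0 hTu.symm
      obtain ⟨S1⟩ := hu T hTu
      obtain ⟨S2⟩ := ih (S \ T) (Finset.sdiff_ssubset hTS hTne)
        (fun i hi => hd i (Finset.mem_sdiff.mp hi).1)
        (IsReciprocalStable.of_add (hsum ▸ hS) hus)
      obtain ⟨e⟩ := Finset.nonempty_pi_linearEquiv_prod (R := K[X])
        (fun i => K[X] ⧸ Ideal.span {d i}) hTS
      exact ⟨(S1.prod S2).congr e⟩

end Family

/-! ### Multiplicities of elementary divisors from kernel sizes -/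

section Multiplicity

/-- The number of solutions of `g • v = 0` in a cyclic module. -/
theorem natCard_smul_eq_zero_quotient {R : Type*} [CommRing R] [IsDomain R] {D F' g' : R}
    (hF' : F' ≠ 0) (hD : D ≠ 0) (hc : IsCoprime F' g') :
    Nat.card {v : R ⧸ Ideal.span {D * F'} // (D * g') • v = 0} =
      Nat.card (R ⧸ Ideal.span {D}) := by
  -- Multiplication by `F'` has kernel `(D)`, and its image is exactly the set killed by `D g'`,
  -- since `g'` is prime to `F'`.
  let f : R →ₗ[R] R ⧸ Ideal.span {D * F'} :=
    (Ideal.span {D * F'}).mkQ.comp (LinearMap.mulLeft R F')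
  have hf : ∀ a, f a = Ideal.Quotient.mk _ (F' * a) := fun a => rfl
  have hk : Ideal.span {D} = LinearMap.ker f := by
    ext a
    rw [Ideal.mem_span_singleton, LinearMap.mem_ker, hf, Ideal.Quotient.eq_zero_iff_mem,
      Ideal.mem_span_singleton, mul_comm D, mul_dvd_mul_iff_left hF']
  have hr : ∀ v, v ∈ LinearMap.range f ↔ (D * g') • v = 0 := fun v => by
    obtain ⟨a, rfl⟩ := Ideal.Quotient.mk_surjective v
    rw [Ideal.Quotient.smul_eq_mk_mul, ← map_mul, Ideal.Quotient.eq_zero_iff_mem,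
      Ideal.mem_span_singleton, mul_assoc, mul_dvd_mul_iff_left hD, LinearMap.mem_range]
    constructor
    · rintro ⟨b, hb⟩
      rw [hf, Ideal.Quotient.eq, Ideal.mem_span_singleton] at hb
      have h1 : F' ∣ a := by
        have h2 := (Dvd.intro_left D rfl : F' ∣ D * F').trans hb
        exact (dvd_sub_right (dvd_mul_right F' b)).mp h2
      exact h1.mul_left g'
    · intro h
      obtain ⟨b, rfl⟩ := hc.dvd_of_dvd_mul_left h
      exact ⟨b, hf b⟩
  refine Nat.card_congr (((Submodule.quotEquivOfEq _ _ hk).trans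
    f.quotKerEquivRange).toEquiv.trans (Equiv.subtypeEquivRight hr)).symm

variable {K : Type*} [Field K]

theorem Polynomial.natCard_quotient_span [Finite K] {D : K[X]} (hD : D ≠ 0) :
    Nat.card (K[X] ⧸ Ideal.span {D}) = Nat.card K ^ D.natDegree := by
  have : Module.Finite K (K[X] ⧸ Ideal.span {D}) :=
    Module.Finite.of_basis (AdjoinRoot.powerBasis hD).basis
  rw [Module.natCard_eq_pow_finrank (K := K), finrank_quotient_span_eq_natDegree]

/-- The kernel of `Q ^ k` on `K[X]/(P ^ e)` has the size of `K[X]/(D)`, with `D` the gcd of `P ^ e`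
and `Q ^ k`. -/
theorem natCard_pow_smul_eq_zero_quotient_pow [Finite K] {P Q : K[X]} (hP : P.Monic)
    (hPi : Irreducible P) (hQ : Q.Monic) (hQi : Irreducible Q) (k e : ℕ) :
    open Classical in
    Nat.card {v : K[X] ⧸ Ideal.span {P ^ e} // Q ^ k • v = 0} =
      Nat.card K ^ (Q.natDegree * if P = Q then min k e else 0) := by
  classical
  split_ifs with h
  · subst h
    have h1 := natCard_smul_eq_zero_quotient (R := K[X]) (D := P ^ min k e)
      (F' := P ^ (e - min k e)) (g' := P ^ (k - min k e))
      (pow_ne_zero _ hPi.ne_zero) (pow_ne_zero _ hPi.ne_zero) (by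
        rcases Nat.le_total k e with h | h
        · rw [min_eq_left h, Nat.sub_self, pow_zero]; exact isCoprime_one_right
        · rw [min_eq_right h, Nat.sub_self, pow_zero]; exact isCoprime_one_left)
    rw [← pow_add, ← pow_add, Nat.add_sub_cancel' (min_le_right k e),
      Nat.add_sub_cancel' (min_le_left k e),
      natCard_quotient_span (pow_ne_zero _ hPi.ne_zero), natDegree_pow, mul_comm (min k e)] at h1
    exact h1
  · have hcop : IsCoprime P Q := by
      rw [hPi.coprime_iff_not_dvd]
      exact fun hd => h (eq_of_monic_of_associated hP hQ (hPi.associated_of_dvd hQi hd))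
    have h1 := natCard_smul_eq_zero_quotient (R := K[X]) (D := 1) (F' := P ^ e) (g' := Q ^ k)
      (pow_ne_zero _ hPi.ne_zero) one_ne_zero hcop.pow
    rw [natCard_quotient_span one_ne_zero, natDegree_one] at h1
    rw [one_mul, one_mul] at h1
    rw [h1, mul_zero]

theorem natCard_smul_eq_zero_pi {R ι : Type*} [Ring R] [Fintype ι] (A : ι → Type*)
    [∀ i, AddCommGroup (A i)] [∀ i, Module R (A i)] (g : R) :
    Nat.card {v : (i : ι) → A i // g • v = 0} = ∏ i, Nat.card {a : A i // g • a = 0} := by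
  rw [← Nat.card_pi]
  refine Nat.card_congr ((Equiv.subtypeEquivRight fun v => ?_).trans
    (Equiv.subtypePiEquivPi (p := fun i (a : A i) => g • a = 0)))
  exact funext_iff

/-- Two monic irreducible polynomials of the same degree have powers of the same multiplicities
among the elementary divisors if their powers have kernels of the same size. -/
theorem familyMultiplicity_pow_eq [Finite K] {r : ℕ} (d : Fin r → K[X])
    (hd : ∀ i, ∃ (P : K[X]) (k : ℕ), P.Monic ∧ Irreducible P ∧ 0 < k ∧ d i = P ^ k)
    {Q Q' : K[X]} (hQ : Q.Monic) (hQi : Irreducible Q) (hQ' : Q'.Monic) (hQi' : Irreducible Q')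
    (hdeg : Q'.natDegree = Q.natDegree)
    (hcard : ∀ k, Nat.card {v : (i : Fin r) → K[X] ⧸ Ideal.span {d i} // Q' ^ k • v = 0} =
      Nat.card {v : (i : Fin r) → K[X] ⧸ Ideal.span {d i} // Q ^ k • v = 0})
    {k : ℕ} (hk : 0 < k) : familyMultiplicity d (Q' ^ k) = familyMultiplicity d (Q ^ k) := by
  classical
  choose P e hP hPi he hdP using hd
  obtain rfl : d = fun i => P i ^ e i := funext hdP
  let m : K[X] → ℕ → ℕ := fun R j => ∑ i, if P i = R then min j (e i) else 0
  have hm : ∀ (R : K[X]) (j : ℕ), R.Monic → Irreducible R →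
      Nat.card {v : (i : Fin r) → K[X] ⧸ Ideal.span {P i ^ e i} // R ^ j • v = 0} =
        Nat.card K ^ (R.natDegree * m R j) := fun R j hR hRi => by
    rw [natCard_smul_eq_zero_pi (fun i => K[X] ⧸ Ideal.span {P i ^ e i})]
    simp only [natCard_pow_smul_eq_zero_quotient_pow (hP _) (hPi _) hR hRi]
    rw [Finset.prod_pow_eq_pow_sum, ← Finset.mul_sum]
  have hmm : ∀ j, m Q' j = m Q j := fun j => by
    have h1 := hcard j
    rw [hm Q' j hQ' hQi', hm Q j hQ hQi, hdeg] at h1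
    exact Nat.eq_of_mul_eq_mul_left hQi.natDegree_pos
      (Nat.pow_right_injective (Finite.one_lt_card (α := K)) h1)
  obtain ⟨j, rfl⟩ : ∃ j, k = j + 1 := ⟨k - 1, by omega⟩
  -- Second difference: `2 min(j+1, e) - min(j, e) - min(j+2, e)` is `1` if `e = j + 1` and `0`
  -- otherwise.
  have hcount : ∀ R : K[X], R.Monic → Irreducible R →
      2 * m R (j + 1) = m R j + m R (j + 2) +
        familyMultiplicity (fun i => P i ^ e i) (R ^ (j + 1)) := fun R hR hRi => by
    have h1 : familyMultiplicity (fun i => P i ^ e i) (R ^ (j + 1)) =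
        ∑ i, if P i = R ∧ e i = j + 1 then 1 else 0 := by
      rw [familyMultiplicity, Nat.card_eq_fintype_card, Fintype.card_subtype,
        Finset.card_filter]
      refine Finset.sum_congr rfl fun i _ => ?_
      simp only [pow_eq_pow_iff_of_irreducible (hP i) (hPi i) hR hRi (he i)]
    rw [h1, Finset.mul_sum, ← Finset.sum_add_distrib, ← Finset.sum_add_distrib]
    refine Finset.sum_congr rfl fun i _ => ?_
    by_cases h2 : P i = R
    · simp only [h2, if_true, true_and]
      split_ifs <;> omega
    · simp [h2]
  have h1 := hcount Q hQ hQi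
  have h2 := hcount Q' hQ' hQi'
  rw [hmm, hmm, hmm] at h2
  omega

end Multiplicity

/-! ### Kernel sizes of polynomials in a unitary matrix -/

section Kernel

variable {K n : Type*} [Field K] [Fintype n]

theorem Matrix.natCard_ker_eq_pow [Finite K] (M : Matrix n n K) :
    Nat.card {v : n → K // M.mulVec v = 0} = Nat.card K ^ (Fintype.card n - M.rank) := by
  have h1 : Nat.card {v : n → K // M.mulVec v = 0} = Nat.card (LinearMap.ker M.mulVecLin) :=
    Nat.card_congr (Equiv.subtypeEquivRight fun v => by simp)
  rw [h1, Module.natCard_eq_pow_finrank (K := K)]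
  have h2 := LinearMap.finrank_range_add_finrank_ker M.mulVecLin
  rw [Module.finrank_fintype_fun_eq_card] at h2
  rw [Matrix.rank, ← h2, Nat.add_sub_cancel_left]

theorem Matrix.natCard_ker_map {σ : K →+* K} (hσσ : ∀ a, σ (σ a) = a) (M : Matrix n n K) :
    Nat.card {v : n → K // (M.map σ).mulVec v = 0} = Nat.card {v : n → K // M.mulVec v = 0} := by
  -- Entrywise `σ` is only semilinear, but it is a bijection, which is enough for counting.
  let e : (n → K) ≃ (n → K) := ⟨fun v => σ ∘ v, fun v => σ ∘ v, fun v => funext fun i => hσσ _,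
    fun v => funext fun i => hσσ _⟩
  refine (Nat.card_congr (e.subtypeEquiv fun v => ?_)).symm
  change _ ↔ (M.map σ).mulVec (σ ∘ v) = 0
  rw [funext_iff, funext_iff]
  refine forall_congr' fun i => ?_
  rw [← RingHom.map_mulVec, Pi.zero_apply, map_eq_zero]

theorem Matrix.natCard_ker_transpose [Finite K] (M : Matrix n n K) :
    Nat.card {v : n → K // M.transpose.mulVec v = 0} = Nat.card {v : n → K // M.mulVec v = 0} := by
  rw [Matrix.natCard_ker_eq_pow, Matrix.natCard_ker_eq_pow, Matrix.rank_transpose]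

variable [DecidableEq n]

theorem Matrix.natCard_ker_unit_mul {U : Matrix n n K} (hU : IsUnit U) (M : Matrix n n K) :
    Nat.card {v : n → K // (U * M).mulVec v = 0} = Nat.card {v : n → K // M.mulVec v = 0} := by
  refine Nat.card_congr (Equiv.subtypeEquivRight fun v => ?_)
  rw [← Matrix.mulVec_mulVec]
  have h := Matrix.mulVec_injective_iff_isUnit.mpr hU
  exact ⟨fun h1 => h (by rw [h1, Matrix.mulVec_zero]), fun h1 => by rw [h1, Matrix.mulVec_zero]⟩

theorem Matrix.natCard_ker_mul_unit [Finite K] {U : Matrix n n K} (hU : IsUnit U)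
    (M : Matrix n n K) :
    Nat.card {v : n → K // (M * U).mulVec v = 0} = Nat.card {v : n → K // M.mulVec v = 0} := by
  rw [← Matrix.natCard_ker_transpose, Matrix.transpose_mul, Matrix.natCard_ker_unit_mul,
    Matrix.natCard_ker_transpose]
  exact (Matrix.isUnit_transpose U).mpr hU

theorem Matrix.natCard_smul_aEval' (A : Matrix n n K) (g : K[X]) :
    Nat.card {v : Module.AEval' (Matrix.toLin' A) // g • v = 0} =
      Nat.card {v : n → K // (aeval A g).mulVec v = 0} := by
  refine (Nat.card_congr ((Module.AEval'.of (Matrix.toLin' A)).toEquiv.subtypeEquiv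
    fun v => ?_)).symm
  have h1 : aeval (Matrix.toLin' A) g = Matrix.toLin' (aeval A g) :=
    aeval_algHom_apply (Matrix.toLinAlgEquiv' (R := K) (n := n)).toAlgHom A g
  have h2 := Module.AEval.of_aeval_smul (R := K) (a := Matrix.toLin' A) g v
  rw [h1] at h2
  change _ ↔ g • Module.AEval.of K (n → K) (Matrix.toLin' A) v = 0
  rw [← h2, LinearEquiv.map_eq_zero_iff]
  rfl

theorem aeval_reverse_eq {B : Type*} [Ring B] [Algebra K B] {a b : B} (hab : a * b = 1)
    (g : K[X]) : aeval a g.reverse = a ^ g.natDegree * aeval b g := by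
  have hpow : ∀ i, a ^ i * b ^ i = 1 := fun i => by
    induction i with
    | zero => simp
    | succ i ih => rw [pow_succ, pow_succ', mul_assoc, ← mul_assoc a, hab, one_mul, ih]
  -- `reverse` is not additive; `reflect N` with a fixed bound `N` is.
  suffices h : ∀ N, ∀ f : K[X], f.natDegree ≤ N → aeval a (reflect N f) = a ^ N * aeval b f from
    h _ _ le_rfl
  intro N f hf
  refine induction_with_natDegree_le (fun f => aeval a (reflect N f) = a ^ N * aeval b f) N
    (by simp) (fun i c _ hi => ?_) (fun f g _ _ h1 h2 => ?_) f hf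
  · rw [reflect_C_mul_X_pow, revAt_le hi, map_mul, map_mul, aeval_C, aeval_C, map_pow, map_pow,
      aeval_X, aeval_X, ← mul_assoc, ← Algebra.commutes, mul_assoc]
    congr 1
    conv_rhs => rw [← Nat.sub_add_cancel hi, pow_add, mul_assoc, hpow, mul_one]
  · rw [reflect_add, map_add, map_add, h1, h2, mul_add]

/-- The sizes of the kernels of `g(A)` are invariant under the passage to reciprocals and under
`σ`, for a unitary matrix similar to its inverse. -/
theorem Matrix.natCard_ker_aeval_recip_and_map [Finite K] {σ : K →+* K}
    (hσσ : ∀ a, σ (σ a) = a) {A G : Matrix n n K} (hA : A * A.sesquiTranspose σ = 1)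
    (hG : IsUnit G) (hGA : G * A = A.sesquiTranspose σ * G) {g : K[X]} (h0 : g.coeff 0 ≠ 0) :
    Nat.card {v : n → K // (aeval A g.recip).mulVec v = 0} =
        Nat.card {v : n → K // (aeval A g).mulVec v = 0} ∧
      Nat.card {v : n → K // (aeval A (g.map σ)).mulVec v = 0} =
        Nat.card {v : n → K // (aeval A g).mulVec v = 0} := by
  have hsim : ∀ f : K[X], Nat.card {v : n → K // (aeval (A.sesquiTranspose σ) f).mulVec v = 0} =
      Nat.card {v : n → K // (aeval A f).mulVec v = 0} := fun f => by
    have h1 : G * aeval A f = aeval (A.sesquiTranspose σ) f * G := by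
      induction f using Polynomial.induction_on' with
      | add a b ha hb => rw [map_add, map_add, mul_add, add_mul, ha, hb]
      | monomial k a =>
        have h2 : SemiconjBy G (A ^ k) (A.sesquiTranspose σ ^ k) :=
          SemiconjBy.pow_right hGA k
        rw [aeval_monomial, aeval_monomial, mul_assoc, ← h2.eq, ← mul_assoc, ← mul_assoc,
          Algebra.commutes]
    rw [← Matrix.natCard_ker_mul_unit hG, ← h1, Matrix.natCard_ker_unit_mul hG]
  have hAu : IsUnit A := IsUnit.of_mul_eq_one _ hA
  constructor
  -- Up to invertible factors the reciprocal at `A` is `g(A⁻¹) = g(A*)`, and `A*` is similar to `A`.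
  · rw [recip, map_mul, aeval_reverse_eq hA, aeval_C, Matrix.natCard_ker_unit_mul,
      Matrix.natCard_ker_unit_mul (hAu.pow _), hsim]
    exact (inv_ne_zero h0).isUnit.map (algebraMap K (Matrix n n K))
  -- `g^σ(A*)` is the conjugate transpose of `g(A)`.
  · rw [← hsim, ← Matrix.sesquiTranspose_aeval, Matrix.sesquiTranspose,
      Matrix.natCard_ker_transpose, Matrix.natCard_ker_map hσσ]

end Kernel

/-! ### Passage to the standard Hermitian form -/

theorem Commute.aeval_right {K B : Type*} [CommSemiring K] [Semiring B] [Algebra K B] {a b : B}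
    (h : Commute a b) (g : K[X]) : Commute a (aeval b g) := by
  induction g using Polynomial.induction_on' with
  | add f f' hf hf' => rw [map_add]; exact hf.add_right hf'
  | monomial k c =>
    rw [aeval_monomial]
    exact Commute.mul_right (Algebra.commutes c a).symm (h.pow_right k)

/-- A unitary matrix whose module carries a reversible Hermitian structure is inverted by a
unitary involution. -/
theorem Matrix.exists_unitary_involution {K n : Type*} [Field K] [Finite K] [Fintype n]
    [DecidableEq n] {σ : K →+* K} (hσ : ∀ a, σ (σ a) = a)
    (hnorm : ∀ z, σ z = z → ∃ a, a * σ a = z) (htr : ∃ l, l + σ l = 1)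
    (hsq : (2 : K) ≠ 0 → ∀ z, σ z = z → ∃ y, y ^ 2 = z) {A : Matrix n n K}
    (hA : A * A.sesquiTranspose σ = 1)
    (S : ReversibleHermitianStructure σ (Module.AEval' (Matrix.toLin' A))) :
    ∃ s : Matrix n n K, s * s.sesquiTranspose σ = 1 ∧ s * s = 1 ∧ A * s * A = s := by
  obtain ⟨H, s, hH, hHs, hAH, hsH, hss, hAs⟩ := S.exists_matrix
  obtain ⟨g, hg⟩ := Matrix.exists_aeval_mul_eq σ hσ hnorm htr hsq H hH hHs
  have hHA : Commute A H := by
    have h1 : A * H = A * (A.sesquiTranspose σ * H * A) := by rw [hAH]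
    rw [← mul_assoc, ← mul_assoc, hA, one_mul] at h1
    exact h1
  have hbA : Commute A (aeval H g) := hHA.aeval_right g
  generalize aeval H g = b at hg hbA
  have hb : IsUnit b := by
    obtain ⟨u, rfl⟩ := hH
    have h1 : ((u⁻¹ : (Matrix n n K)ˣ) : Matrix n n K) * b.sesquiTranspose σ * b = 1 := by
      rw [mul_assoc, hg, Units.inv_mul]
    exact IsUnit.of_mul_eq_one _ (mul_eq_one_comm.mp h1)
  obtain ⟨b', hbb'⟩ := hb.exists_right_inv
  have hb'b : b' * b = 1 := mul_eq_one_comm.mp hbb'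
  have hb'A : A * b' = b' * A := by
    calc A * b' = b' * b * (A * b') := by rw [hb'b, one_mul]
      _ = b' * (b * A) * b' := by simp only [mul_assoc]
      _ = b' * (A * b) * b' := by rw [hbA.eq]
      _ = b' * A * (b * b') := by simp only [mul_assoc]
      _ = b' * A := by rw [hbb', mul_one]
  -- `b` is an isometry from the form `H = b*b` to the standard form, and it commutes with `A`.
  refine ⟨b * s * b', mul_eq_one_comm.mp ?_, ?_, ?_⟩
  · rw [Matrix.sesquiTranspose_mul, Matrix.sesquiTranspose_mul]
    calc b'.sesquiTranspose σ * (s.sesquiTranspose σ * b.sesquiTranspose σ) * (b * s * b')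
        = b'.sesquiTranspose σ * (s.sesquiTranspose σ * (b.sesquiTranspose σ * b) * s) * b' := by
          simp only [mul_assoc]
      _ = b'.sesquiTranspose σ * (b.sesquiTranspose σ * b) * b' := by rw [hg, hsH]
      _ = (b * b').sesquiTranspose σ * (b * b') := by
          rw [Matrix.sesquiTranspose_mul]; simp only [mul_assoc]
      _ = 1 := by rw [hbb', Matrix.sesquiTranspose_one, one_mul]
  · calc b * s * b' * (b * s * b') = b * (s * (b' * b) * s) * b' := by simp only [mul_assoc]
      _ = 1 := by rw [hb'b, mul_one, hss, mul_one, hbb']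
  · calc A * (b * s * b') * A = A * b * s * (b' * A) := by simp only [mul_assoc]
      _ = b * A * s * (A * b') := by rw [hbA.eq, hb'A]
      _ = b * (A * s * A) * b' := by simp only [mul_assoc]
      _ = b * s * b' := by rw [hAs]

/-- If `P = XQ`, the class of `P ^ (k - 1) Q` is nonzero and killed by `X`, although `A` is
invertible. -/
theorem coeff_zero_ne_zero_of_linearEquiv_aEval' {K : Type*} [Field K] {n r : ℕ} {A : Matrix (Fin n) (Fin n) K}
    (hA : IsUnit A) {d : Fin r → K[X]}
    (e : Module.AEval' (Matrix.toLin' A) ≃ₗ[K[X]] ((i : Fin r) → K[X] ⧸ Ideal.span {d i}))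
    {i : Fin r} {P : K[X]} {k : ℕ} (hPi : Irreducible P) (hk : 0 < k)
    (hd : d i = P ^ k) : P.coeff 0 ≠ 0 := by
  intro h0
  obtain ⟨Q, rfl⟩ := X_dvd_iff.mpr h0
  have hinj : ∀ v : (i : Fin r) → K[X] ⧸ Ideal.span {d i}, (X : K[X]) • v = 0 → v = 0 := by
    intro v hv
    rw [← e.symm.map_eq_zero_iff]
    have h1 : (X : K[X]) • e.symm v = 0 := by rw [← map_smul, hv, map_zero]
    obtain ⟨w, hw⟩ := (Module.AEval'.of (Matrix.toLin' A)).surjective (e.symm v)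
    rw [← hw, Module.AEval'.X_smul_of, LinearEquiv.map_eq_zero_iff, Matrix.toLin'_apply] at h1
    rw [← hw, Matrix.mulVec_injective_iff_isUnit.mpr hA (h1.trans (Matrix.mulVec_zero A).symm),
      map_zero]
  have hne : (X * Q) ^ (k - 1) * Q ≠ 0 :=
    mul_ne_zero (pow_ne_zero _ hPi.ne_zero) (right_ne_zero_of_mul hPi.ne_zero)
  have hX : X * ((X * Q) ^ (k - 1) * Q) = d i := by
    rw [hd]
    conv_rhs => rw [← Nat.sub_add_cancel hk, pow_succ]
    ring
  have h1 := hinj (Pi.single i (Ideal.Quotient.mk _ ((X * Q) ^ (k - 1) * Q))) (by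
    rw [← Pi.single_smul, Ideal.Quotient.smul_eq_mk_mul, ← map_mul, hX,
      Ideal.Quotient.eq_zero_iff_mem.mpr (Ideal.mem_span_singleton_self _), Pi.single_zero])
  rw [Pi.single_eq_zero_iff, Ideal.Quotient.eq_zero_iff_mem, Ideal.mem_span_singleton, ← hX] at h1
  have h2 : X * ((X * Q) ^ (k - 1) * Q) ∣ 1 * ((X * Q) ^ (k - 1) * Q) := by rwa [one_mul]
  exact not_isUnit_X (isUnit_of_dvd_one ((mul_dvd_mul_iff_right hne).mp h2))

theorem count_map_univ_eq_familyMultiplicity {α : Type*} [DecidableEq α] {r : ℕ} (d : Fin r → α)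
    (g : α) : ((Finset.univ : Finset (Fin r)).val.map d).count g = familyMultiplicity d g := by
  rw [Multiset.count_map, familyMultiplicity, Nat.card_eq_fintype_card, Fintype.card_subtype]
  simp only [eq_comm (a := g)]
  rfl

/-- Existence of the reversible Hermitian structure for a unitary matrix similar to its inverse
with the parity condition on its elementary divisors. -/
theorem IsElementaryDivisors.nonempty_structure {K : Type*} [Field K] [Finite K] {σ : K →+* K}
    (hσσ : ∀ a, σ (σ a) = a) {n r : ℕ} {A G : Matrix (Fin n) (Fin n) K}
    (hA : A * A.sesquiTranspose σ = 1) (hG : IsUnit G) (hGA : G * A = A.sesquiTranspose σ * G)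
    {d : Fin r → K[X]} (hd : IsElementaryDivisors A d)
    (hpar : ∀ (a : K) (k : ℕ), a = 1 ∨ a = -1 → 0 < k →
      ¬ ((2 : K) ≠ 0 ∧ Odd k ∨ (2 : K) = 0 ∧ Even k) →
      Even (familyMultiplicity d ((X - C a) ^ k))) :
    Nonempty (ReversibleHermitianStructure σ (Module.AEval' (Matrix.toLin' A))) := by
  classical
  obtain ⟨hd, ⟨e⟩⟩ := hd
  have hAu : IsUnit A := IsUnit.of_mul_eq_one _ hA
  have hker : ∀ g : K[X], Nat.card {v : (i : Fin r) → K[X] ⧸ Ideal.span {d i} // g • v = 0} =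
      Nat.card {v : Fin n → K // (aeval A g).mulVec v = 0} := fun g => by
    rw [← Matrix.natCard_smul_aEval']
    refine (Nat.card_congr (e.toEquiv.subtypeEquiv fun v => ?_)).symm
    change g • v = 0 ↔ g • e v = 0
    rw [← map_smul, e.map_eq_zero_iff]
  have hst : IsReciprocalStable σ ((Finset.univ : Finset (Fin r)).val.map d) := by
    refine ⟨fun P k h1 h2 h3 h4 => ?_, fun a k h1 h2 h3 => ?_⟩
    · simp only [count_map_univ_eq_familyMultiplicity]
      have h5 : ∀ j, (P ^ j).coeff 0 ≠ 0 := fun j => by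
        rw [coeff_zero_eq_eval_zero, eval_pow, ← coeff_zero_eq_eval_zero]
        exact pow_ne_zero _ h3
      have h6 := fun j => Matrix.natCard_ker_aeval_recip_and_map hσσ hA hG hGA (h5 j)
      constructor
      · refine familyMultiplicity_pow_eq d hd h1 h2 (monic_recip h3) (irreducible_recip h3 h2)
          (natDegree_recip h3) (fun j => ?_) h4
        rw [hker, hker, ← recip_pow, (h6 j).1]
      · refine familyMultiplicity_pow_eq d hd h1 h2 (h1.map σ)
          (irreducible_map_of_involutive hσσ h2) (natDegree_map σ) (fun j => ?_) h4
        rw [hker, hker, ← Polynomial.map_pow, (h6 j).2]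
    · rw [count_map_univ_eq_familyMultiplicity]
      exact hpar a k h1 h2 h3
  obtain ⟨S⟩ := hst.nonempty_structure hσσ d Finset.univ fun i _ => by
    obtain ⟨P, k, hP, hPi, hk, hdi⟩ := hd i
    exact ⟨P, k, hP, hPi, coeff_zero_ne_zero_of_linearEquiv_aEval' hAu e hPi hk hdi, hk, hdi⟩
  let e' : ((i : ↥(Finset.univ : Finset (Fin r))) → K[X] ⧸ Ideal.span {d i}) ≃ₗ[K[X]]
      ((i : Fin r) → K[X] ⧸ Ideal.span {d i}) :=
    LinearEquiv.piCongrLeft K[X] (fun i => K[X] ⧸ Ideal.span {d i})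
      (Equiv.subtypeUnivEquiv fun i => Finset.mem_univ i)
  exact ⟨S.congr (e.trans e'.symm)⟩

/-! ### The main theorem -/

theorem mainTheorem9 (n p f q : ℕ) (hn : 0 < n) (hp : p.Prime) (hq : q = p ^ f)
    (K : Type*) [Field K] [ExpChar K p] (hK : Nat.card K = q ^ 2)
    (x : finiteUnitaryGroup n p f K) (hx : IsRealElement x)
    (r : ℕ) (d : Fin r → K[X])
    (hd : IsElementaryDivisors ((x : GL (Fin n) K) : Matrix (Fin n) (Fin n) K) d)
    (h : (Odd q ∧ ∀ m : ℕ, 1 ≤ m →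
            Even (familyMultiplicity d ((X - 1) ^ (2 * m))) ∧
            Even (familyMultiplicity d ((X + 1) ^ (2 * m)))) ∨
         (Even q ∧ Even n ∧ ∀ m : ℕ,
            Even (familyMultiplicity d ((X + 1) ^ (2 * m + 1))))) :
    IsStronglyRealElement x := by
  have hq0 : 0 < q := hq ▸ Nat.pow_pos hp.pos
  have hfin : Finite K := Nat.finite_of_card_ne_zero (by rw [hK]; positivity)
  let σ : K →+* K := iterateFrobenius K p f
  have hσ : ∀ a, σ a = a ^ q := fun a => by rw [hq]; exact iterateFrobenius_def p f a
  have hσσ : ∀ a, σ (σ a) = a := fun a => by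
    rw [hσ, hσ, pow_pow_eq_self_of_natCard_eq_sq hK hfin]
  have hnorm : ∀ z, σ z = z → ∃ a, a * σ a = z := fun z hz => by
    simp only [hσ] at hz ⊢
    exact exists_mul_pow_eq_of_natCard_eq_sq hK hfin z hz
  have htr := exists_add_map_eq_one hσ hK hfin
  have h2odd : Odd q → (2 : K) ≠ 0 := fun hodd h2 => by
    have := Fintype.ofFinite K
    have h3 : ringChar K = 2 := by
      have := CharTwo.of_one_ne_zero_of_two_eq_zero (one_ne_zero (α := K)) h2
      exact ringChar.eq K 2
    have h4 := FiniteField.even_card_of_char_two h3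
    rw [← Nat.card_eq_fintype_card, hK, ← Nat.even_iff] at h4
    exact Nat.not_even_iff_odd.mpr hodd.pow h4
  have h2even : Even q → (2 : K) = 0 := fun heven => by
    by_contra h2
    have := Fintype.ofFinite K
    have h3 : ringChar K ≠ 2 := fun h3 => h2 (by
      have := (ringChar.spec K 2).mpr (by rw [h3])
      exact_mod_cast this)
    have h4 := FiniteField.odd_card_of_char_ne_two h3
    rw [← Nat.card_eq_fintype_card, hK, ← Nat.odd_iff] at h4
    exact Nat.not_even_iff_odd.mpr h4 (heven.pow_of_ne_zero two_ne_zero)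
  have hsq : (2 : K) ≠ 0 → ∀ z, σ z = z → ∃ y, y ^ 2 = z := fun h2 z hz => by
    rw [hσ] at hz
    refine exists_sq_eq_of_natCard_eq_sq hK hfin ?_ z hz
    by_contra hodd
    exact h2 (h2even (Nat.not_odd_iff_even.mp hodd))
  let A : Matrix (Fin n) (Fin n) K := ((x : GL (Fin n) K) : Matrix (Fin n) (Fin n) K)
  have hA : A * A.sesquiTranspose σ = 1 := x.2
  have hinv : (((x⁻¹ : finiteUnitaryGroup n p f K) : GL (Fin n) K) : Matrix (Fin n) (Fin n) K) =
      A.sesquiTranspose σ := by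
    have h1 : (((x⁻¹ : finiteUnitaryGroup n p f K) : GL (Fin n) K) :
        Matrix (Fin n) (Fin n) K) * A = 1 := by
      rw [InvMemClass.coe_inv]
      exact Units.inv_mul _
    calc _ = _ * (A * A.sesquiTranspose σ) := by rw [hA, mul_one]
      _ = A.sesquiTranspose σ := by rw [← mul_assoc, h1, one_mul]
  obtain ⟨c, hc⟩ := isConj_iff.mp hx
  -- Reality enters the construction of the form only through this similarity between `A` and `A* =
  -- A⁻¹`.
  have hGA : ((c : GL (Fin n) K) : Matrix (Fin n) (Fin n) K) * A =
      A.sesquiTranspose σ * ((c : GL (Fin n) K) : Matrix (Fin n) (Fin n) K) := by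
    rw [← hinv, ← hc]
    simp only [A, ← Units.val_mul, ← Subgroup.coe_mul, inv_mul_cancel_right]
  obtain ⟨S⟩ := hd.nonempty_structure hσσ hA (Units.isUnit (c : GL (Fin n) K)) hGA
    (fun a k ha hk hbad => by
      rcases h with ⟨hodd, h⟩ | ⟨heven, -, h⟩
      · have hk2 : Even k := by
          by_contra hk2
          exact hbad (Or.inl ⟨h2odd hodd, Nat.not_even_iff_odd.mp hk2⟩)
        obtain ⟨m, rfl⟩ := hk2.exists_two_nsmul
        rw [smul_eq_mul]
        obtain ⟨h3, h4⟩ := h m (by rw [smul_eq_mul] at hk; omega)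
        rcases ha with rfl | rfl
        · rwa [C_1]
        · rwa [C_neg, C_1, sub_neg_eq_add]
      · have hk2 : Odd k := by
          by_contra hk2
          exact hbad (Or.inr ⟨h2even heven, Nat.not_odd_iff_even.mp hk2⟩)
        obtain ⟨m, rfl⟩ := hk2
        -- In characteristic 2 the two exceptional polynomials `X ∓ 1` coincide.
        have ha1 : a = -1 := by
          rcases ha with rfl | rfl
          · linear_combination h2even heven
          · rfl
        rw [ha1, C_neg, C_1, sub_neg_eq_add]
        exact h m)
  obtain ⟨s, hs1, hs2, hs3⟩ := Matrix.exists_unitary_involution hσσ hnorm htr hsq hA S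
  let t : finiteUnitaryGroup n p f K := ⟨⟨s, s, hs2, hs2⟩, hs1⟩
  have ht : t * t = 1 := Subtype.ext (Units.ext hs2)
  have htx : x * t * x = t := Subtype.ext (Units.ext hs3)
  have horder : ∀ z : finiteUnitaryGroup n p f K, z * z = 1 → z ≠ 1 → orderOf z = 2 :=
    fun z hz hz1 => orderOf_eq_prime (by rw [sq, hz]) hz1
  -- If `t = 1` then `x² = 1`, and any involution commuting with `x` will do: `-1` for `q` odd; for
  -- `q` even, `x` itself, or a transposition matrix if `x = 1`, available because `n ≥ 2`.
  by_cases ht1 : t = 1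
  · have hxx : x * x = 1 := by rw [ht1, mul_one] at htx; exact htx
    have hxi : x⁻¹ = x := inv_eq_of_mul_eq_one_left hxx
    rcases h with ⟨hodd, -⟩ | ⟨-, hneven, -⟩
    · let z : finiteUnitaryGroup n p f K := ⟨⟨-1, -1, by simp, by simp⟩, by
        change (-1 : Matrix (Fin n) (Fin n) K) * ((-1 : Matrix (Fin n) (Fin n) K).map σ).transpose
          = 1
        have : (-1 : Matrix (Fin n) (Fin n) K).map σ = -1 := by
          change σ.mapMatrix (-1) = -1
          rw [map_neg, map_one]
        rw [this, Matrix.transpose_neg, Matrix.transpose_one, neg_mul_neg, one_mul]⟩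
      have hzz : z * z = 1 := Subtype.ext (Units.ext (by
        change (-1 : Matrix (Fin n) (Fin n) K) * -1 = 1
        rw [neg_mul_neg, one_mul]))
      have hzx : z * x = x * z := Subtype.ext (Units.ext (by
        change (-1 : Matrix (Fin n) (Fin n) K) * A = A * -1
        rw [neg_one_mul, mul_neg_one]))
      refine ⟨z, horder z hzz fun h1 => h2odd hodd ?_, by
        rw [hzx, mul_inv_cancel_right, hxi]⟩
      have h3 : (-1 : Matrix (Fin n) (Fin n) K) = 1 :=
        congrArg (fun y : finiteUnitaryGroup n p f K =>
          ((y : GL (Fin n) K) : Matrix (Fin n) (Fin n) K)) h1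
      have h4 := congrFun (congrFun h3 ⟨0, hn⟩) ⟨0, hn⟩
      rw [Matrix.neg_apply, Matrix.one_apply_eq] at h4
      linear_combination -h4
    · by_cases hx1 : x = 1
      · have hn2 : 1 < n := by
          obtain ⟨j, hj⟩ := hneven
          omega
        let w : Equiv.Perm (Fin n) := Equiv.swap ⟨0, hn⟩ ⟨1, hn2⟩
        have hww : w.permMatrix K * w.permMatrix K = 1 := by
          rw [← Matrix.permMatrix_mul, Equiv.swap_mul_self, Matrix.permMatrix_one]
        let z : finiteUnitaryGroup n p f K :=
          ⟨⟨w.permMatrix K, w.permMatrix K, hww, hww⟩, by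
            change w.permMatrix K * ((w.permMatrix K).map σ).transpose = 1
            have : (w.permMatrix K).map σ = w.permMatrix K := by
              ext i j
              simp only [Matrix.map_apply, Equiv.Perm.permMatrix, PEquiv.toMatrix_apply]
              split_ifs
              · exact map_one σ
              · exact map_zero σ
            rw [this, Matrix.transpose_permMatrix, Equiv.swap_inv, hww]⟩
        refine ⟨z, horder z (Subtype.ext (Units.ext hww)) fun h1 => ?_, by
          rw [hx1, mul_one, mul_inv_cancel, inv_one]⟩
        have h3 : w.permMatrix K = 1 :=
          congrArg (fun y : finiteUnitaryGroup n p f K =>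
            ((y : GL (Fin n) K) : Matrix (Fin n) (Fin n) K)) h1
        have h4 := congrFun (congrFun h3 ⟨0, hn⟩) ⟨1, hn2⟩
        simp [w, Equiv.Perm.permMatrix, PEquiv.toMatrix_apply] at h4
      · exact ⟨x, horder x hxx hx1, by rw [mul_inv_cancel_right, hxi]⟩
  · refine ⟨t, horder t ht ht1, ?_⟩
    rw [inv_eq_of_mul_eq_one_left ht, eq_inv_iff_mul_eq_one, mul_assoc t x t]
    calc t * (x * t) * x = t * (x * t * x) := by simp only [mul_assoc]
      _ = 1 := by rw [htx, ht]
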